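/- Let $\mathcal D$ be a triangulated category with translation functor $[1]$, and let $\mathcal A$ be a full additive subcategory of $\mathcal D$ (a full subcategory that is itself an additive category; it need not be closed under isomorphisms). Then the following three statements are equivalent. 1. There is a hereditary $t$-structure on $\mathcal D$ with heart $\mathcal A$. That is, there is a $t$-structure $(\mathcal D^{\le 0},\mathcal D^{\ge 0})$ on $\mathcal D$, with $\mathcal D^{\le 0}$ and $\mathcal D^{\ge 0}$ closed under isomorphisms, whose heart $\mathcal D^{\le 0}\cap\mathcal D^{\ge 0}$ is the closure of $\mathcal A$ under isomorphisms in $\mathcal D$ (so it equals $\mathcal A$ if $\mathcal A$ is closed under isomorphisms), which is bounded (each object lies in $\mathcal D^{\le 0}[-n]\cap\mathcal D^{\ge 0}[-m]$ for some integers $m,n$), and such that $\mathrm{Hom}_{\mathcal D}(X,Y[n])=0$ for all $X,Y$ in the heart and all $n\ge 2$. 2. $\mathcal D=\mathrm{add}\,(\bigcup_{n\in\mathbb Z}\mathcal A[n])$, and $\mathrm{Hom}_{\mathcal D}(X,Y[m])=0$ for all $X,Y\in\mathcal A$ and all $m<0$. Here $\mathrm{add}\,\mathcal S$ denotes the smallest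 full additive subcategory of $\mathcal D$ that contains $\mathcal S$ and is closed under isomorphisms; closure under direct summands is not required. 3. The category $\mathcal A$ is abelian and hereditary (that is, its Yoneda extension groups $\mathrm{Ext}^n_{\mathcal A}(X,Y)$ vanish for all objects $X,Y$ and all $n\ge 2$), and there is an equivalence of categories $F\colon \mathbf D^b(\mathcal A)\to\mathcal D$ that commutes with the translation functors (there is a natural isomorphism $F\circ[1]\cong[1]\circ F$) and respects the canonical embedding of $\mathcal A$ (the composite of $F$ with the embedding $\mathcal A\to\mathbf D^b(\mathcal A)$ as stalk complexes in degree $0$ is naturally isomorphic to the inclusion $\mathcal A\to\mathcal D$). The equivalence $F$ is not required to be a triangle functor. A triangulated category $\mathcal D$ is called hereditary if it has a full additive subcategory $\mathcal A$ satisfying these equivalent conditions. -/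

import Mathlib

open CategoryTheory CategoryTheory.Limits CategoryTheory.Triangulated

universe v u

namespace HereditaryTriangulated

/-- An abelian category is hereditary if its Yoneda extension groups vanish in all degrees `≥ 2`,
i.e. if it has global dimension at most one. -/
def IsHereditaryAbelian (A : Type u) [Category.{v} A] [Abelian A] : Prop :=
  letI : HasExt.{max u v} A := HasExt.standard A
  ∀ (X Y : A) (n : ℕ), 2 ≤ n → Subsingleton (Abelian.Ext.{max u v} X Y n)

section DerivedCategory

variable (A : Type u) [Category.{v} A] [Abelian A] [HasDerivedCategory.{max u v} A]

/-- The canonical embedding of an abelian category into its bounded derived category; it sends an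
object to the stalk complex concentrated in degree zero. -/
noncomputable def canonicalEmbedding : A ⥤ DerivedCategory.Bounded A :=
  (DerivedCategory.TStructure.t (C := A)).bounded.lift (DerivedCategory.singleFunctor A 0)
    (fun _ => ⟨⟨0, inferInstance⟩, ⟨0, inferInstance⟩⟩)

end DerivedCategory

section Triangulated

variable {D : Type u} [Category.{v} D] [Preadditive D] [HasZeroObject D] [HasShift D ℤ]
  [∀ n : ℤ, (shiftFunctor D n).Additive] [Pretriangulated D]

/-- `add S`: the smallest full additive subcategory which contains `S` and is closed under
isomorphisms. Closure under direct summands is not required. -/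
inductive addClosure (S : ObjectProperty D) : ObjectProperty D
  | of_mem (X : D) (hX : S X) : addClosure S X
  | of_isZero (X : D) (hX : IsZero X) : addClosure S X
  | biprod (X Y : D) (hX : addClosure S X) (hY : addClosure S Y) : addClosure S (X ⊞ Y)
  | of_iso (X Y : D) (e : X ≅ Y) (hX : addClosure S X) : addClosure S Y

/-- A t-structure is hereditary if it is bounded and there are no nonzero morphisms `X ⟶ Y[n]`
for `X`, `Y` in the heart and `n ≥ 2`. -/
structure IsHereditaryTStructure (t : TStructure D) : Prop where
  bounded (X : D) : t.bounded X
  hom_eq_zero (X Y : D) (hX : t.heart X) (hY : t.heart Y) (n : ℤ) (hn : 2 ≤ n)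
    (f : X ⟶ Y⟦n⟧) : f = 0

/-- There is a hereditary t-structure whose heart is the full subcategory `P`. The heart is always
closed under isomorphisms, so it is compared with the isomorphism closure of `P` (which is `P`
itself as soon as `P` is closed under isomorphisms). -/
def IsHeartOfHereditaryTStructure (P : ObjectProperty D) : Prop :=
  ∃ t : TStructure D, IsHereditaryTStructure t ∧ t.heart = P.isoClosure

/-- Every object belongs to `add (⋃ₙ P[n])`, and there are no nonzero morphisms from `P` to `P[m]`
for `m < 0`. -/
def IsGeneratingWithoutNegativeHom (P : ObjectProperty D) : Prop :=
  (∀ X : D, addClosure (⨆ n : ℤ, P.map (shiftFunctor D n)) X) ∧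
    ∀ (X Y : D), P X → P Y → ∀ m : ℤ, m < 0 → ∀ f : X ⟶ Y⟦m⟧, f = 0

/-- The full subcategory `P` is a hereditary abelian category, and there is an equivalence of
categories `F` from its bounded derived category to `D` such that `F` commutes with the translation
functors (there is a natural isomorphism `F (X[1]) ≅ (F X)[1]`) and the composition of `F` with the
canonical embedding is isomorphic to the inclusion. -/
def IsHereditaryAbelianWithDerivedEquivalence (P : ObjectProperty D) : Prop :=
  ∃ _ : Abelian P.FullSubcategory, IsHereditaryAbelian P.FullSubcategory ∧
    letI : HasDerivedCategory.{max u v} P.FullSubcategory :=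
      HasDerivedCategory.standard P.FullSubcategory
    ∃ F : DerivedCategory.Bounded P.FullSubcategory ⥤ D,
      F.IsEquivalence ∧
      Nonempty (shiftFunctor (DerivedCategory.Bounded P.FullSubcategory) (1 : ℤ) ⋙ F ≅
        F ⋙ shiftFunctor D (1 : ℤ)) ∧
      Nonempty (canonicalEmbedding P.FullSubcategory ⋙ F ≅ P.ι)

variable (D) in
/-- A triangulated category is hereditary if it has a hereditary t-structure whose heart is some
full additive subcategory. -/
def IsHereditaryTriangulated : Prop :=
  ∃ (P : ObjectProperty D) (_ : HasFiniteBiproducts P.FullSubcategory),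
    IsHeartOfHereditaryTStructure P

end Triangulated

end HereditaryTriangulated

/-!
The equivalence of the first two conditions is a matter of splitting truncation triangles. If the
t-structure `t` is hereditary, an induction on the amplitude shows that the connecting morphisms
of the truncation triangles vanish, so that each object is a direct sum of shifts of objects of
the heart (`addClosure_of_bounded`). Conversely, if each object is such a direct sum and there are
no morphisms of negative degree, then sorting the summands by degree gives the truncation
triangles (`generatedTStructure`), and a morphism `f : X ⟶ Y⟦n⟧` with `n ≥ 2` vanishes because the
decomposition of its cone forces `Y⟦n⟧` to be a direct summand of the cone
(`hom_eq_zero_of_two_le`).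

The heart `A` of a hereditary t-structure is abelian, and `D` is determined by `A`: its objects
are finite direct sums of shifts of objects of `A`, and the only morphisms between these are the
morphisms of `A` in degree `0` and the extensions in degree `1`, which can be read off the short
exact sequences of `A` (`IsHeartEmbedding`, `mapExtension`). The products of two morphisms of
degree `1` vanish, so that the graded category of morphisms between objects of `A` is the same for
two such embeddings of `A` (`gradedIso`). This is applied to `D` and to the derived category of
`A`. An equivalence is then obtained by choosing, for each bounded complex, an object of `D` with
the same summands (`Matching`), and by transporting the matrices of morphisms (`matchingFunctor`).
It is compatible with shifts and with `A`, but nothing is claimed about triangles.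

This requires that `A` is hereditary, i.e. that morphisms of degree `≥ 2` between stalk complexes
vanish. In the derived category, morphisms of positive degree are effaceable
(`exists_epi_comp_eq_zero`), hence they are products of morphisms of degree `1`; a product of two
of these is zero if the first extension lifts along the epimorphism of the second one, and this
property of short exact sequences of `A` can be checked in `D`
(`IsHeartEmbedding.comp_shift_eq_zero`).

Finally, an equivalence with the bounded derived category of a hereditary abelian category which
commutes with shifts transports the decomposition of bounded complexes into stalk complexes and
the vanishing of their morphisms of negative degree.
-/

namespace HereditaryTriangulated

open Pretriangulated ZeroObject

/-! ### Isomorphisms of graded categories of morphisms -/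

section ShiftedHom

variable {C : Type*} [Category* C] [HasShift C ℤ]

/-- The morphism `X⟦i⟧ ⟶ Y⟦j⟧` obtained by shifting `f : X ⟶ Y⟦n⟧`, where `n + i = j`. -/
noncomputable def shiftedHomUp {X Y : C} {n : ℤ} (f : ShiftedHom X Y n) (i j : ℤ)
    (h : n + i = j) : X⟦i⟧ ⟶ Y⟦j⟧ :=
  f⟦i⟧' ≫ (shiftFunctorAdd' C n i j h).inv.app Y

lemma shiftedHomUp_comp {X Y Z : C} {a b c : ℤ} (f : ShiftedHom X Y a) (g : ShiftedHom Y Z b)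
    (hc : b + a = c) (i j k : ℤ) (hij : a + i = j) (hjk : b + j = k) :
    shiftedHomUp f i j hij ≫ shiftedHomUp g j k hjk =
      shiftedHomUp (f.comp g hc) i k (by lia) := by
  have hnat := (shiftFunctorAdd' C a i j hij).inv.naturality g
  dsimp only [Functor.comp_map, Functor.comp_obj] at hnat
  simp only [shiftedHomUp, ShiftedHom.comp, Functor.map_comp, Category.assoc]
  rw [shiftFunctorAdd'_assoc_inv_app b a i c j k hc hij (by lia), ← reassoc_of% hnat]

lemma shiftedHomUp_mk₀ {X Y : C} (f : X ⟶ Y) (i : ℤ) :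
    shiftedHomUp (ShiftedHom.mk₀ (0 : ℤ) rfl f) i i (zero_add i) = f⟦i⟧' := by
  simp only [shiftedHomUp, ShiftedHom.mk₀, Functor.map_comp, Category.assoc,
    shiftFunctorAdd'_zero_add_inv_app]
  rw [← Functor.map_comp]
  simp [shiftFunctorZero']

lemma shift_map_shiftedHomUp {X Y : C} {n : ℤ} (f : ShiftedHom X Y n) (i j s : ℤ)
    (h : n + i = j) :
    (shiftedHomUp f i j h)⟦s⟧' ≫ (shiftFunctorAdd' C j s (j + s) rfl).inv.app Y =
      (shiftFunctorAdd' C i s (i + s) rfl).inv.app X ≫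
        shiftedHomUp f (i + s) (j + s) (by lia) := by
  have hnat := (shiftFunctorAdd' C i s (i + s) rfl).inv.naturality f
  dsimp only [Functor.comp_map, Functor.comp_obj] at hnat
  simp only [shiftedHomUp, Functor.map_comp, Category.assoc]
  rw [shiftFunctorAdd'_assoc_inv_app n i s j (i + s) (j + s) h rfl (by lia),
    reassoc_of% hnat]

variable [Preadditive C] [∀ n : ℤ, (shiftFunctor C n).Additive]

/-- Shifting by `i` is an additive bijection from morphisms `X ⟶ Y⟦n⟧` to morphisms
`X⟦i⟧ ⟶ Y⟦j⟧`, where `n + i = j`. -/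
noncomputable def shiftedHomUpEquiv (X Y : C) (n i j : ℤ) (h : n + i = j) :
    ShiftedHom X Y n ≃+ (X⟦i⟧ ⟶ Y⟦j⟧) where
  toFun f := shiftedHomUp f i j h
  invFun g := (shiftFunctor C i).preimage (g ≫ (shiftFunctorAdd' C n i j h).hom.app Y)
  left_inv f := (shiftFunctor C i).map_injective (by
    simp only [Functor.map_preimage, shiftedHomUp, Category.assoc, Iso.inv_hom_id_app]
    exact Category.comp_id _)
  right_inv g := by simp [shiftedHomUp]
  map_add' f g := by simp [shiftedHomUp]

lemma shiftedHomUpEquiv_apply {X Y : C} {n : ℤ} (f : ShiftedHom X Y n) (i j : ℤ)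
    (h : n + i = j) : shiftedHomUpEquiv X Y n i j h f = shiftedHomUp f i j h := rfl

end ShiftedHom

section GradedIso

variable {A C D : Type*} [Category* A]
  [Category* C] [Preadditive C] [HasShift C ℤ] [∀ n : ℤ, (shiftFunctor C n).Additive]
  [Category* D] [Preadditive D] [HasShift D ℤ] [∀ n : ℤ, (shiftFunctor D n).Additive]

/-- An isomorphism between the graded categories with the objects of `A` whose morphisms of
degree `n` from `X` to `Y` are the morphisms `ι X ⟶ (ι Y)⟦n⟧`, respectively
`ι' X ⟶ (ι' Y)⟦n⟧`, which is the identity on objects and on the morphisms coming from `A`. -/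
structure GradedIso (ι : A ⥤ C) (ι' : A ⥤ D) where
  /-- the additive bijections in each degree -/
  equiv (X Y : A) (n : ℤ) :
    ShiftedHom (ι.obj X) (ι.obj Y) n ≃+ ShiftedHom (ι'.obj X) (ι'.obj Y) n
  equiv_mk₀ {X Y : A} (f : X ⟶ Y) :
    equiv X Y 0 (ShiftedHom.mk₀ 0 rfl (ι.map f)) = ShiftedHom.mk₀ 0 rfl (ι'.map f)
  equiv_comp {X Y Z : A} {a b c : ℤ} (f : ShiftedHom (ι.obj X) (ι.obj Y) a)
    (g : ShiftedHom (ι.obj Y) (ι.obj Z) b) (h : b + a = c) :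
    equiv X Z c (f.comp g h) = (equiv X Y a f).comp (equiv Y Z b g) h

namespace GradedIso

variable {ι : A ⥤ C} {ι' : A ⥤ D} (ψ : GradedIso ι ι')

/-- The inverse isomorphism. -/
def symm : GradedIso ι' ι where
  equiv X Y n := (ψ.equiv X Y n).symm
  equiv_mk₀ f := by rw [AddEquiv.symm_apply_eq, ψ.equiv_mk₀]
  equiv_comp f g h := by
    rw [AddEquiv.symm_apply_eq, ψ.equiv_comp, AddEquiv.apply_symm_apply,
      AddEquiv.apply_symm_apply]

/-- The action of an isomorphism of graded categories on morphisms between shifts of objects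
of `A`. -/
noncomputable def onShifts (X Y : A) (i j : ℤ) :
    ((ι.obj X)⟦i⟧ ⟶ (ι.obj Y)⟦j⟧) ≃+ ((ι'.obj X)⟦i⟧ ⟶ (ι'.obj Y)⟦j⟧) :=
  (shiftedHomUpEquiv _ _ (j - i) i j (by lia)).symm.trans
    ((ψ.equiv X Y (j - i)).trans (shiftedHomUpEquiv _ _ (j - i) i j (by lia)))

lemma onShifts_shiftedHomUp {X Y : A} {n : ℤ} (f : ShiftedHom (ι.obj X) (ι.obj Y) n)
    (i j : ℤ) (h : n + i = j) :
    ψ.onShifts X Y i j (shiftedHomUp f i j h) = shiftedHomUp (ψ.equiv X Y n f) i j h := by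
  obtain rfl : n = j - i := by lia
  simp [onShifts, ← shiftedHomUpEquiv_apply]

lemma exists_eq_shiftedHomUp {X Y : A} {i j : ℤ} (f : (ι.obj X)⟦i⟧ ⟶ (ι.obj Y)⟦j⟧) :
    ∃ g : ShiftedHom (ι.obj X) (ι.obj Y) (j - i), f = shiftedHomUp g i j (by lia) :=
  ⟨(shiftedHomUpEquiv _ _ (j - i) i j (by lia)).symm f, by
    rw [← shiftedHomUpEquiv_apply, AddEquiv.apply_symm_apply]⟩

lemma onShifts_symm_apply {X Y : A} {i j : ℤ} (f : (ι.obj X)⟦i⟧ ⟶ (ι.obj Y)⟦j⟧) :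
    ψ.symm.onShifts X Y i j (ψ.onShifts X Y i j f) = f := by
  obtain ⟨f, rfl⟩ := exists_eq_shiftedHomUp f
  simp [onShifts_shiftedHomUp, symm]

lemma onShifts_comp {X Y Z : A} {i j k : ℤ} (f : (ι.obj X)⟦i⟧ ⟶ (ι.obj Y)⟦j⟧)
    (g : (ι.obj Y)⟦j⟧ ⟶ (ι.obj Z)⟦k⟧) :
    ψ.onShifts X Z i k (f ≫ g) = ψ.onShifts X Y i j f ≫ ψ.onShifts Y Z j k g := by
  obtain ⟨f, rfl⟩ := exists_eq_shiftedHomUp f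
  obtain ⟨g, rfl⟩ := exists_eq_shiftedHomUp g
  rw [shiftedHomUp_comp _ _ (show (k - j) + (j - i) = k - i by lia), onShifts_shiftedHomUp,
    onShifts_shiftedHomUp, onShifts_shiftedHomUp, ψ.equiv_comp, shiftedHomUp_comp]

lemma onShifts_map {X Y : A} (f : X ⟶ Y) (i : ℤ) :
    ψ.onShifts X Y i i ((ι.map f)⟦i⟧') = (ι'.map f)⟦i⟧' := by
  rw [← shiftedHomUp_mk₀, onShifts_shiftedHomUp, ψ.equiv_mk₀, shiftedHomUp_mk₀]

lemma onShifts_id (X : A) (i : ℤ) : ψ.onShifts X X i i (𝟙 _) = 𝟙 _ := by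
  simpa using ψ.onShifts_map (𝟙 X) i

lemma onShifts_shift {X Y : A} {i j : ℤ} (f : (ι.obj X)⟦i⟧ ⟶ (ι.obj Y)⟦j⟧) (s : ℤ) :
    ψ.onShifts X Y (i + s) (j + s) ((shiftFunctorAdd' C i s (i + s) rfl).hom.app (ι.obj X) ≫
      f⟦s⟧' ≫ (shiftFunctorAdd' C j s (j + s) rfl).inv.app (ι.obj Y)) =
    (shiftFunctorAdd' D i s (i + s) rfl).hom.app (ι'.obj X) ≫
      (ψ.onShifts X Y i j f)⟦s⟧' ≫
        (shiftFunctorAdd' D j s (j + s) rfl).inv.app (ι'.obj Y) := by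
  obtain ⟨f, rfl⟩ := exists_eq_shiftedHomUp f
  rw [shift_map_shiftedHomUp, onShifts_shiftedHomUp, shift_map_shiftedHomUp,
    Iso.hom_inv_id_app_assoc, Iso.hom_inv_id_app_assoc, onShifts_shiftedHomUp]

end GradedIso

end GradedIso

/-! ### Direct sums of shifts -/

section Splitting

variable {C D : Type*} [Category* C] [Preadditive C] [Category* D] [Preadditive D]

/-- A decomposition of an object `Z` as the direct sum of a finite family of objects `S k`. -/
structure Splitting {J : Type} [Fintype J] (S : J → C) (Z : C) where
  /-- the inclusions of the summands -/
  inj (k : J) : S k ⟶ Z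
  /-- the projections onto the summands -/
  proj (k : J) : Z ⟶ S k
  inj_proj_self (k : J) : inj k ≫ proj k = 𝟙 _
  inj_proj_ne (k l : J) (h : k ≠ l) : inj k ≫ proj l = 0
  total : ∑ k, proj k ≫ inj k = 𝟙 Z

namespace Splitting

variable {J : Type} [Fintype J] {S : J → C} {Z : C}

lemma hom_ext {J' : Type} [Fintype J'] {S' : J' → C} {W : C} (z : Splitting S Z)
    (w : Splitting S' W) {f g : Z ⟶ W}
    (h : ∀ k l, z.inj k ≫ f ≫ w.proj l = z.inj k ≫ g ≫ w.proj l) : f = g := by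
  have key (f : Z ⟶ W) :
      f = ∑ k, ∑ l, z.proj k ≫ (z.inj k ≫ f ≫ w.proj l) ≫ w.inj l := by
    conv_lhs => rw [← Category.id_comp f, ← Category.comp_id f, ← z.total, ← w.total]
    simp only [Preadditive.sum_comp, Preadditive.comp_sum, Category.assoc]
    exact Finset.sum_comm
  rw [key f, key g]
  simp only [h]

lemma comp_eq_sum (z : Splitting S Z) {W V : C} (f : W ⟶ Z) (g : Z ⟶ V) :
    f ≫ g = ∑ m, (f ≫ z.proj m) ≫ z.inj m ≫ g := by
  conv_lhs => rw [← Category.id_comp g, ← z.total]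
  simp only [Preadditive.sum_comp, Preadditive.comp_sum, Category.assoc]

/-- Transport of a decomposition along an isomorphism. -/
@[simps]
def ofIso (z : Splitting S Z) {Z' : C} (e : Z ≅ Z') : Splitting S Z' where
  inj k := z.inj k ≫ e.hom
  proj k := e.inv ≫ z.proj k
  inj_proj_self k := by simp [z.inj_proj_self]
  inj_proj_ne k l h := by simp [z.inj_proj_ne k l h]
  total := by
    have := z.total
    calc ∑ k, (e.inv ≫ z.proj k) ≫ z.inj k ≫ e.hom
        = e.inv ≫ (∑ k, z.proj k ≫ z.inj k) ≫ e.hom := by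
          simp [Preadditive.sum_comp, Preadditive.comp_sum]
      _ = 𝟙 Z' := by simp [this]

/-- Replacement of the summands of a decomposition by isomorphic ones. -/
@[simps]
def congr (z : Splitting S Z) {S' : J → C} (e : ∀ k, S k ≅ S' k) : Splitting S' Z where
  inj k := (e k).inv ≫ z.inj k
  proj k := z.proj k ≫ (e k).hom
  inj_proj_self k := by simp [reassoc_of% z.inj_proj_self k]
  inj_proj_ne k l h := by simp [reassoc_of% z.inj_proj_ne k l h]
  total := by simp [z.total]

/-- The image of a decomposition by an additive functor. -/
@[simps]
def map (z : Splitting S Z) (G : C ⥤ D) [G.Additive] :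
    Splitting (fun k => G.obj (S k)) (G.obj Z) where
  inj k := G.map (z.inj k)
  proj k := G.map (z.proj k)
  inj_proj_self k := by rw [← G.map_comp, z.inj_proj_self, G.map_id]
  inj_proj_ne k l h := by rw [← G.map_comp, z.inj_proj_ne k l h, G.map_zero]
  total := by simp only [← G.map_comp, ← G.map_sum, z.total, G.map_id]

/-- The decomposition of a zero object as an empty direct sum. -/
def empty (S : Empty → C) (hZ : IsZero Z) : Splitting S Z where
  inj k := k.elim
  proj k := k.elim
  inj_proj_self k := k.elim
  inj_proj_ne k := k.elim
  total := hZ.eq_of_src _ _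

/-- The decomposition of an object with a single summand. -/
@[simps]
def single (S : Unit → C) (e : S () ≅ Z) : Splitting S Z where
  inj _ := e.hom
  proj _ := e.inv
  inj_proj_self _ := e.hom_inv_id
  inj_proj_ne k l h := (h rfl).elim
  total := by simp

/-- The decomposition of a biproduct. -/
noncomputable def biprod [HasBinaryBiproducts C] {J' : Type} [Fintype J'] (S : J ⊕ J' → C)
    {Z' : C} (z : Splitting (fun k => S (Sum.inl k)) Z)
    (z' : Splitting (fun k => S (Sum.inr k)) Z') : Splitting S (Z ⊞ Z') where
  inj
    | Sum.inl k => z.inj k ≫ biprod.inl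
    | Sum.inr k => z'.inj k ≫ biprod.inr
  proj
    | Sum.inl k => biprod.fst ≫ z.proj k
    | Sum.inr k => biprod.snd ≫ z'.proj k
  inj_proj_self k := by
    rcases k with k | k <;> simp [z.inj_proj_self, z'.inj_proj_self]
  inj_proj_ne k l h := by
    rcases k with k | k <;> rcases l with l | l
    · simpa using z.inj_proj_ne k l (fun e => h (by rw [e]))
    · simp
    · simp
    · simpa using z'.inj_proj_ne k l (fun e => h (by rw [e]))
  total := by
    have h₁ : ∑ k, ((biprod.fst : Z ⊞ Z' ⟶ Z) ≫ z.proj k) ≫ z.inj k ≫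
        (biprod.inl : Z ⟶ Z ⊞ Z') =
        biprod.fst ≫ (∑ k, z.proj k ≫ z.inj k) ≫ biprod.inl := by
      simp [Preadditive.sum_comp, Preadditive.comp_sum]
    have h₂ : ∑ k, ((biprod.snd : Z ⊞ Z' ⟶ Z') ≫ z'.proj k) ≫ z'.inj k ≫
        (biprod.inr : Z' ⟶ Z ⊞ Z') =
        biprod.snd ≫ (∑ k, z'.proj k ≫ z'.inj k) ≫ biprod.inr := by
      simp [Preadditive.sum_comp, Preadditive.comp_sum]
    rw [Fintype.sum_sum_type, h₁, h₂, z.total, z'.total]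
    simp

end Splitting

end Splitting

section Matching

variable {A C D : Type*} [Category* A]
  [Category* C] [Preadditive C] [HasShift C ℤ] [∀ n : ℤ, (shiftFunctor C n).Additive]
  [Category* D] [Preadditive D] [HasShift D ℤ] [∀ n : ℤ, (shiftFunctor D n).Additive]

/-- Decompositions of `Z` and `Z'` as direct sums of shifts of objects of `A`, which are embedded
by `ι`, respectively `ι'`, with the same objects of `A` and the same shifts. -/
structure Matching (ι : A ⥤ C) (ι' : A ⥤ D) (Z : C) (Z' : D) where
  /-- the index set of the summands -/
  J : Type
  /-- the index set is finite -/
  [fintype : Fintype J]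
  /-- the objects of `A` -/
  X : J → A
  /-- the shifts -/
  d : J → ℤ
  /-- the decomposition of `Z` -/
  left : Splitting (fun k => (ι.obj (X k))⟦d k⟧) Z
  /-- the decomposition of `Z'` -/
  right : Splitting (fun k => (ι'.obj (X k))⟦d k⟧) Z'

attribute [instance] Matching.fintype

namespace Matching

variable {ι : A ⥤ C} {ι' : A ⥤ D}

/-- Exchange of the roles of the two objects. -/
def symm {Z : C} {Z' : D} (z : Matching ι ι' Z Z') : Matching ι' ι Z' Z where
  J := z.J
  X := z.X
  d := z.d
  left := z.right
  right := z.left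

/-- Transport along isomorphisms. -/
def ofIso {Z W : C} {Z' W' : D} (z : Matching ι ι' Z Z') (e : Z ≅ W) (e' : Z' ≅ W') :
    Matching ι ι' W W' where
  J := z.J
  X := z.X
  d := z.d
  left := z.left.ofIso e
  right := z.right.ofIso e'

/-- Zero objects are matched. -/
def zero {Z : C} {Z' : D} (hZ : IsZero Z) (hZ' : IsZero Z') : Matching ι ι' Z Z' where
  J := Empty
  X k := k.elim
  d k := k.elim
  left := .empty _ hZ
  right := .empty _ hZ'

/-- The direct sum of two matchings. -/
noncomputable def biprod [HasBinaryBiproducts C] [HasBinaryBiproducts D] {Z W : C} {Z' W' : D}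
    (z : Matching ι ι' Z Z') (w : Matching ι ι' W W') : Matching ι ι' (Z ⊞ W) (Z' ⊞ W') where
  J := z.J ⊕ w.J
  X := Sum.elim z.X w.X
  d := Sum.elim z.d w.d
  left := .biprod _ z.left w.left
  right := .biprod _ z.right w.right

/-- The matching of the two images of an object of `A`. -/
noncomputable def single (ι : A ⥤ C) (ι' : A ⥤ D) (X : A) :
    Matching ι ι' (ι.obj X) (ι'.obj X) where
  J := Unit
  X _ := X
  d _ := 0
  left := .single _ ((shiftFunctorZero C ℤ).app _)
  right := .single _ ((shiftFunctorZero D ℤ).app _)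

/-- The shift of a matching. -/
noncomputable def shift {Z : C} {Z' : D} (z : Matching ι ι' Z Z') (s : ℤ) :
    Matching ι ι' (Z⟦s⟧) (Z'⟦s⟧) where
  J := z.J
  X := z.X
  d k := z.d k + s
  left := (z.left.map (shiftFunctor C s)).congr
    (fun k => (shiftFunctorAdd' C (z.d k) s _ rfl).symm.app (ι.obj (z.X k)))
  right := (z.right.map (shiftFunctor D s)).congr
    (fun k => (shiftFunctorAdd' D (z.d k) s _ rfl).symm.app (ι'.obj (z.X k)))

variable (ψ : GradedIso ι ι')

/-- The morphism `Z' ⟶ W'` whose matrix corresponds to the matrix of `f : Z ⟶ W` under the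
isomorphism `ψ`. -/
noncomputable def transfer {Z W : C} {Z' W' : D} (z : Matching ι ι' Z Z')
    (w : Matching ι ι' W W') (f : Z ⟶ W) : Z' ⟶ W' :=
  ∑ k, ∑ l, z.right.proj k ≫
    ψ.onShifts _ _ _ _ (z.left.inj k ≫ f ≫ w.left.proj l) ≫ w.right.inj l

variable {Z W V : C} {Z' W' V' : D} (z : Matching ι ι' Z Z') (w : Matching ι ι' W W')
  (v : Matching ι ι' V V')

lemma inj_transfer_proj (f : Z ⟶ W) (k : z.J) (l : w.J) :
    z.right.inj k ≫ z.transfer ψ w f ≫ w.right.proj l =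
      ψ.onShifts _ _ _ _ (z.left.inj k ≫ f ≫ w.left.proj l) := by
  simp only [transfer, Preadditive.sum_comp, Preadditive.comp_sum, Category.assoc]
  rw [Finset.sum_eq_single k, Finset.sum_eq_single l]
  · rw [reassoc_of% z.right.inj_proj_self k, w.right.inj_proj_self l, Category.comp_id]
  · intro l' _ h
    rw [w.right.inj_proj_ne l' l h]
    simp
  · simp
  · intro k' _ h
    refine Finset.sum_eq_zero (fun l' _ => ?_)
    rw [reassoc_of% z.right.inj_proj_ne k k' h.symm, zero_comp]
  · simp

lemma eq_transfer (f : Z ⟶ W) (f' : Z' ⟶ W')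
    (h : ∀ k l, z.right.inj k ≫ f' ≫ w.right.proj l =
      ψ.onShifts _ _ _ _ (z.left.inj k ≫ f ≫ w.left.proj l)) :
    f' = z.transfer ψ w f :=
  z.right.hom_ext w.right (fun k l => by rw [h, inj_transfer_proj])

lemma transfer_id : z.transfer ψ z (𝟙 Z) = 𝟙 Z' := by
  refine (z.eq_transfer ψ z _ _ (fun k l => ?_)).symm
  rw [Category.id_comp, Category.id_comp]
  by_cases h : k = l
  · subst h
    rw [z.right.inj_proj_self, z.left.inj_proj_self, ψ.onShifts_id]
  · rw [z.right.inj_proj_ne k l h, z.left.inj_proj_ne k l h, map_zero]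

lemma transfer_comp (f : Z ⟶ W) (g : W ⟶ V) :
    z.transfer ψ v (f ≫ g) = z.transfer ψ w f ≫ w.transfer ψ v g := by
  refine (z.eq_transfer ψ v _ _ (fun k l => ?_)).symm
  have h₁ : z.left.inj k ≫ (f ≫ g) ≫ v.left.proj l =
      ∑ m, (z.left.inj k ≫ f ≫ w.left.proj m) ≫ w.left.inj m ≫ g ≫ v.left.proj l := by
    simpa using w.left.comp_eq_sum (z.left.inj k ≫ f) (g ≫ v.left.proj l)
  have h₂ : z.right.inj k ≫ (z.transfer ψ w f ≫ w.transfer ψ v g) ≫ v.right.proj l =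
      ∑ m, (z.right.inj k ≫ z.transfer ψ w f ≫ w.right.proj m) ≫
        w.right.inj m ≫ w.transfer ψ v g ≫ v.right.proj l := by
    simpa using w.right.comp_eq_sum (z.right.inj k ≫ z.transfer ψ w f)
      (w.transfer ψ v g ≫ v.right.proj l)
  rw [h₁, h₂, map_sum]
  simp only [inj_transfer_proj, ψ.onShifts_comp]

lemma transfer_symm_transfer (f : Z ⟶ W) :
    z.symm.transfer ψ.symm w.symm (z.transfer ψ w f) = f := by
  refine (eq_transfer ψ.symm z.symm w.symm _ _ (fun k l => ?_)).symm
  refine Eq.trans ?_ (congr_arg _ (inj_transfer_proj ψ z w f k l).symm)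
  exact (ψ.onShifts_symm_apply _).symm

lemma transfer_bijective :
    Function.Bijective (z.transfer ψ w : (Z ⟶ W) → (Z' ⟶ W')) :=
  Function.bijective_iff_has_inverse.2 ⟨z.symm.transfer ψ.symm w.symm,
    transfer_symm_transfer ψ z w, transfer_symm_transfer ψ.symm z.symm w.symm⟩

lemma transfer_single {X Y : A} (f : X ⟶ Y) :
    (single ι ι' X).transfer ψ (single ι ι' Y) (ι.map f) = ι'.map f := by
  refine (eq_transfer ψ _ _ _ _ (fun k l => ?_)).symm
  have h₁ : (shiftFunctorZero C ℤ).hom.app (ι.obj X) ≫ ι.map f =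
      (ι.map f)⟦(0 : ℤ)⟧' ≫ (shiftFunctorZero C ℤ).hom.app (ι.obj Y) :=
    ((shiftFunctorZero C ℤ).hom.naturality (ι.map f)).symm
  have h₂ : (shiftFunctorZero D ℤ).hom.app (ι'.obj X) ≫ ι'.map f =
      (ι'.map f)⟦(0 : ℤ)⟧' ≫ (shiftFunctorZero D ℤ).hom.app (ι'.obj Y) :=
    ((shiftFunctorZero D ℤ).hom.naturality (ι'.map f)).symm
  have h₃ : (shiftFunctorZero C ℤ).hom.app (ι.obj X) ≫ ι.map f ≫
      (shiftFunctorZero C ℤ).inv.app (ι.obj Y) = (ι.map f)⟦(0 : ℤ)⟧' := by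
    rw [reassoc_of% h₁, Iso.hom_inv_id_app]
    exact Category.comp_id _
  have h₄ : (shiftFunctorZero D ℤ).hom.app (ι'.obj X) ≫ ι'.map f ≫
      (shiftFunctorZero D ℤ).inv.app (ι'.obj Y) = (ι'.map f)⟦(0 : ℤ)⟧' := by
    rw [reassoc_of% h₂, Iso.hom_inv_id_app]
    exact Category.comp_id _
  exact h₄.trans (((congr_arg _ h₃).trans (ψ.onShifts_map f 0)).symm)

lemma transfer_shift (f : Z ⟶ W) (s : ℤ) :
    (z.shift s).transfer ψ (w.shift s) (f⟦s⟧') = (z.transfer ψ w f)⟦s⟧' := by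
  refine (eq_transfer ψ (z.shift s) (w.shift s) _ _ (fun (k : z.J) (l : w.J) => ?_)).symm
  have h₁ : (z.shift s).left.inj k ≫ f⟦s⟧' ≫ (w.shift s).left.proj l =
      (shiftFunctorAdd' C (z.d k) s _ rfl).hom.app _ ≫
        (z.left.inj k ≫ f ≫ w.left.proj l)⟦s⟧' ≫
          (shiftFunctorAdd' C (w.d l) s _ rfl).inv.app _ := by
    change ((shiftFunctorAdd' C (z.d k) s _ rfl).hom.app _ ≫ (z.left.inj k)⟦s⟧') ≫ f⟦s⟧' ≫
      ((w.left.proj l)⟦s⟧' ≫ (shiftFunctorAdd' C (w.d l) s _ rfl).inv.app _) = _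
    simp
  have h₂ : (z.shift s).right.inj k ≫ (z.transfer ψ w f)⟦s⟧' ≫ (w.shift s).right.proj l =
      (shiftFunctorAdd' D (z.d k) s _ rfl).hom.app _ ≫
        (z.right.inj k ≫ z.transfer ψ w f ≫ w.right.proj l)⟦s⟧' ≫
          (shiftFunctorAdd' D (w.d l) s _ rfl).inv.app _ := by
    change ((shiftFunctorAdd' D (z.d k) s _ rfl).hom.app _ ≫ (z.right.inj k)⟦s⟧') ≫
      (z.transfer ψ w f)⟦s⟧' ≫
        ((w.right.proj l)⟦s⟧' ≫ (shiftFunctorAdd' D (w.d l) s _ rfl).inv.app _) = _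
    simp
  rw [h₁, h₂, inj_transfer_proj ψ z w f k l]
  exact (ψ.onShifts_shift _ s).symm

/-- The isomorphism `Z' ≅ W'` corresponding to an isomorphism `Z ≅ W`. -/
@[simps]
noncomputable def transferIso (e : Z ≅ W) : Z' ≅ W' where
  hom := z.transfer ψ w e.hom
  inv := w.transfer ψ z e.inv
  hom_inv_id := by rw [← transfer_comp, e.hom_inv_id, transfer_id]
  inv_hom_id := by rw [← transfer_comp, e.inv_hom_id, transfer_id]

end Matching

section Functor

variable {ι : A ⥤ C} {ι' : A ⥤ D} (ψ : GradedIso ι ι') {B : Type*} [Category* B] (j : B ⥤ C)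
  (W : B → D) (m : ∀ b, Matching ι ι' (j.obj b) (W b))

/-- The functor which sends an object `b`, such that `j b` is matched with `W b`, to `W b`. -/
@[simps]
noncomputable def matchingFunctor : B ⥤ D where
  obj := W
  map {b b'} f := (m b).transfer ψ (m b') (j.map f)
  map_id b := by rw [j.map_id, Matching.transfer_id]
  map_comp f g := by rw [j.map_comp, Matching.transfer_comp]

lemma isEquivalence_matchingFunctor [j.Full] [j.Faithful]
    (hW : ∀ V : D, ∃ b : B, Nonempty (Matching ι ι' (j.obj b) V)) :
    (matchingFunctor ψ j W m).IsEquivalence where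
  faithful := ⟨fun h => j.map_injective ((Matching.transfer_bijective ψ _ _).1 h)⟩
  full := ⟨fun {b b'} g => by
    obtain ⟨f, hf⟩ := (Matching.transfer_bijective ψ (m b) (m b')).2 g
    exact ⟨j.preimage f, by simp [hf]⟩⟩
  essSurj := ⟨fun V => by
    obtain ⟨b, ⟨v⟩⟩ := hW V
    exact ⟨b, ⟨(m b).transferIso ψ v (Iso.refl _)⟩⟩⟩

/-- The functor attached to a choice of matchings commutes with shifts. -/
noncomputable def matchingFunctorCommShift [HasShift B ℤ] [j.CommShift ℤ] (s : ℤ) :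
    shiftFunctor B s ⋙ matchingFunctor ψ j W m ≅
      matchingFunctor ψ j W m ⋙ shiftFunctor D s :=
  NatIso.ofComponents
    (fun b => (m (b⟦s⟧)).transferIso ψ ((m b).shift s) ((j.commShiftIso s).app b))
    (fun {b b'} f => by
      have h := (j.commShiftIso s).hom.naturality f
      dsimp at h
      change (m (b⟦s⟧)).transfer ψ (m (b'⟦s⟧)) (j.map (f⟦s⟧')) ≫
          (m (b'⟦s⟧)).transfer ψ ((m b').shift s) ((j.commShiftIso s).hom.app b') =
        (m (b⟦s⟧)).transfer ψ ((m b).shift s) ((j.commShiftIso s).hom.app b) ≫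
          ((m b).transfer ψ (m b') (j.map f))⟦s⟧'
      rw [← Matching.transfer_shift, ← Matching.transfer_comp, ← Matching.transfer_comp, h])

/-- The functor attached to a choice of matchings is compatible with the embeddings of `A`. -/
noncomputable def matchingFunctorCompIso (κ : A ⥤ B) (e : κ ⋙ j ≅ ι) :
    κ ⋙ matchingFunctor ψ j W m ≅ ι' :=
  NatIso.ofComponents
    (fun X => (m (κ.obj X)).transferIso ψ (Matching.single ι ι' X) (e.app X))
    (fun {X Y} f => by
      have h := e.hom.naturality f
      dsimp at h
      change (m (κ.obj X)).transfer ψ (m (κ.obj Y)) (j.map (κ.map f)) ≫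
          (m (κ.obj Y)).transfer ψ (Matching.single ι ι' Y) (e.hom.app Y) =
        (m (κ.obj X)).transfer ψ (Matching.single ι ι' X) (e.hom.app X) ≫ ι'.map f
      rw [← Matching.transfer_single ψ f, ← Matching.transfer_comp, ← Matching.transfer_comp, h])

end Functor

end Matching

/-! ### Extensions and morphisms of degree one -/

section HeartEmbedding

variable {A : Type*} [Category* A] [Abelian A]
  {C : Type*} [Category* C] [Preadditive C] [HasZeroObject C] [HasShift C ℤ]
  [∀ n : ℤ, (shiftFunctor C n).Additive] [Pretriangulated C]
  {D : Type*} [Category* D] [Preadditive D] [HasZeroObject D] [HasShift D ℤ]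
  [∀ n : ℤ, (shiftFunctor D n).Additive] [Pretriangulated D]

/-- The properties of the embedding of the heart `A` of a t-structure which make it possible to
identify short exact sequences in `A` with distinguished triangles whose vertices lie in `A`, and
`ι X ⟶ (ι Y)⟦1⟧` with the group of extensions of `X` by `Y` in `A`. -/
structure IsHeartEmbedding (ι : A ⥤ C) : Prop where
  hom_eq_zero ⦃X Y : A⦄ ⦃n : ℤ⦄ (f : ι.obj X ⟶ (ι.obj Y)⟦n⟧) : n < 0 → f = 0
  exists_triangle_of_hom ⦃X Y : A⦄ (δ : ι.obj X ⟶ (ι.obj Y)⟦(1 : ℤ)⟧) :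
    ∃ (E : A) (i : Y ⟶ E) (p : E ⟶ X), Triangle.mk (ι.map i) (ι.map p) δ ∈ distTriang C
  exists_triangle_of_shortExact (S : ShortComplex A) (hS : S.ShortExact) :
    ∃ δ : ι.obj S.X₃ ⟶ (ι.obj S.X₁)⟦(1 : ℤ)⟧,
      Triangle.mk (ι.map S.f) (ι.map S.g) δ ∈ distTriang C

namespace IsHeartEmbedding

variable {ι : A ⥤ C} [ι.Full] [ι.Faithful] [ι.Additive] (hι : IsHeartEmbedding ι)
  {ι' : A ⥤ D} [ι'.Full] [ι'.Faithful] [ι'.Additive] (hι' : IsHeartEmbedding ι')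

include hι in
lemma exists_shortExact {X Y E : A} {i : Y ⟶ E} {p : E ⟶ X}
    {δ : ι.obj X ⟶ (ι.obj Y)⟦(1 : ℤ)⟧}
    (hT : Triangle.mk (ι.map i) (ι.map p) δ ∈ distTriang C) :
    ∃ w : i ≫ p = 0, (ShortComplex.mk i p w).ShortExact := by
  have w : i ≫ p = 0 := ι.map_injective (by
    rw [ι.map_comp, ι.map_zero]
    exact comp_distTriang_mor_zero₁₂ _ hT)
  have hk := AbelianSubcategory.isLimitKernelForkOfDistTriang hι.hom_eq_zero i p δ hT
  have hc := AbelianSubcategory.isColimitCokernelCoforkOfDistTriang hι.hom_eq_zero i p δ hT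
  have : Mono i := mono_of_isLimit_fork hk
  have : Epi p := epi_of_isColimit_cofork hc
  exact ⟨w, { exact := ShortComplex.exact_of_f_is_kernel _ hk }⟩

omit [ι.Additive] in
include hι in
/-- Compatibility of connecting morphisms with morphisms between the ends of two extensions can be
tested in `A`: it means that there is a morphism between the middle terms. -/
lemma comp_eq_comp_iff {X₁ X₂ Y₁ Y₂ E₁ E₂ : A} {i₁ : Y₁ ⟶ E₁} {p₁ : E₁ ⟶ X₁}
    {δ₁ : ι.obj X₁ ⟶ (ι.obj Y₁)⟦(1 : ℤ)⟧} {i₂ : Y₂ ⟶ E₂} {p₂ : E₂ ⟶ X₂}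
    {δ₂ : ι.obj X₂ ⟶ (ι.obj Y₂)⟦(1 : ℤ)⟧}
    (h₁ : Triangle.mk (ι.map i₁) (ι.map p₁) δ₁ ∈ distTriang C)
    (h₂ : Triangle.mk (ι.map i₂) (ι.map p₂) δ₂ ∈ distTriang C)
    (a : Y₁ ⟶ Y₂) (c : X₁ ⟶ X₂) :
    δ₁ ≫ (ι.map a)⟦(1 : ℤ)⟧' = ι.map c ≫ δ₂ ↔
      ∃ b : E₁ ⟶ E₂, i₁ ≫ b = a ≫ i₂ ∧ p₁ ≫ c = b ≫ p₂ := by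
  constructor
  · intro h
    obtain ⟨b, hb₁, hb₂⟩ :=
      complete_distinguished_triangle_morphism₂ _ _ h₁ h₂ (ι.map a) (ι.map c) h
    obtain ⟨b, rfl⟩ := ι.map_surjective b
    refine ⟨b, ι.map_injective ?_, ι.map_injective ?_⟩
    · rw [ι.map_comp, ι.map_comp]
      exact hb₁
    · rw [ι.map_comp, ι.map_comp]
      exact hb₂
  · rintro ⟨b, hb₁, hb₂⟩
    obtain ⟨c', hc₁, hc₂⟩ := complete_distinguished_triangle_morphism _ _ h₁ h₂ (ι.map a)
      (ι.map b) (by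
        change ι.map i₁ ≫ ι.map b = ι.map a ≫ ι.map i₂
        rw [← ι.map_comp, ← ι.map_comp, hb₁])
    change ι.obj X₁ ⟶ ι.obj X₂ at c'
    change ι.map p₁ ≫ c' = ι.map b ≫ ι.map p₂ at hc₁
    obtain ⟨g, hg⟩ := Triangle.yoneda_exact₃ _ h₁ (c' - ι.map c) (by
      change ι.map p₁ ≫ (c' - ι.map c) = 0
      rw [Preadditive.comp_sub, hc₁, ← ι.map_comp, ← ι.map_comp, hb₂, sub_self])
    -- a morphism `(ι Y₁)⟦1⟧ ⟶ ι X₂` is zero, so that `c'` is the image of `c`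
    have hg₀ : g = 0 := AbelianSubcategory.eq_zero_of_hom_shift_pos hι.hom_eq_zero g one_pos
    rw [hg₀, comp_zero] at hg
    have hc : c' = ι.map c := sub_eq_zero.1 hg
    rw [← hc]
    exact hc₂

/-- Two morphisms `δ : ι X ⟶ (ι Y)⟦1⟧` and `δ' : ι' X ⟶ (ι' Y)⟦1⟧` are related when they are the
connecting morphisms of the same extension of `X` by `Y` in `A`. -/
def SameExtension (ι : A ⥤ C) (ι' : A ⥤ D) {X Y : A} (δ : ι.obj X ⟶ (ι.obj Y)⟦(1 : ℤ)⟧)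
    (δ' : ι'.obj X ⟶ (ι'.obj Y)⟦(1 : ℤ)⟧) : Prop :=
  ∃ (E : A) (i : Y ⟶ E) (p : E ⟶ X), Triangle.mk (ι.map i) (ι.map p) δ ∈ distTriang C ∧
    Triangle.mk (ι'.map i) (ι'.map p) δ' ∈ distTriang D

omit [Abelian A] [ι.Full] [ι.Faithful] [ι.Additive] [ι'.Full] [ι'.Faithful] [ι'.Additive] in
lemma SameExtension.symm {X Y : A} {δ : ι.obj X ⟶ (ι.obj Y)⟦(1 : ℤ)⟧}
    {δ' : ι'.obj X ⟶ (ι'.obj Y)⟦(1 : ℤ)⟧} (h : SameExtension ι ι' δ δ') :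
    SameExtension ι' ι δ' δ := by
  obtain ⟨E, i, p, h₁, h₂⟩ := h
  exact ⟨E, i, p, h₂, h₁⟩

include hι hι' in
omit [ι'.Full] [ι'.Faithful] [ι'.Additive] in
lemma exists_sameExtension {X Y : A} (δ : ι.obj X ⟶ (ι.obj Y)⟦(1 : ℤ)⟧) :
    ∃ δ', SameExtension ι ι' δ δ' := by
  obtain ⟨E, i, p, hT⟩ := hι.exists_triangle_of_hom δ
  obtain ⟨w, hS⟩ := hι.exists_shortExact hT
  obtain ⟨δ', hδ'⟩ := hι'.exists_triangle_of_shortExact _ hS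
  exact ⟨δ', E, i, p, hT, hδ'⟩

omit [ι.Additive] [ι'.Additive] in
include hι hι' in
lemma SameExtension.comp_eq_comp_iff {X₁ X₂ Y₁ Y₂ : A}
    {δ₁ : ι.obj X₁ ⟶ (ι.obj Y₁)⟦(1 : ℤ)⟧} {δ₁' : ι'.obj X₁ ⟶ (ι'.obj Y₁)⟦(1 : ℤ)⟧}
    (h₁ : SameExtension ι ι' δ₁ δ₁')
    {δ₂ : ι.obj X₂ ⟶ (ι.obj Y₂)⟦(1 : ℤ)⟧} {δ₂' : ι'.obj X₂ ⟶ (ι'.obj Y₂)⟦(1 : ℤ)⟧}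
    (h₂ : SameExtension ι ι' δ₂ δ₂') (a : Y₁ ⟶ Y₂) (c : X₁ ⟶ X₂) :
    δ₁ ≫ (ι.map a)⟦(1 : ℤ)⟧' = ι.map c ≫ δ₂ ↔
      δ₁' ≫ (ι'.map a)⟦(1 : ℤ)⟧' = ι'.map c ≫ δ₂' := by
  obtain ⟨E₁, i₁, p₁, hT₁, hT₁'⟩ := h₁
  obtain ⟨E₂, i₂, p₂, hT₂, hT₂'⟩ := h₂
  rw [hι.comp_eq_comp_iff hT₁ hT₂, hι'.comp_eq_comp_iff hT₁' hT₂']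

omit [ι.Additive] [ι'.Additive] in
include hι hι' in
lemma SameExtension.eq {X Y : A} {δ : ι.obj X ⟶ (ι.obj Y)⟦(1 : ℤ)⟧}
    {δ₁ δ₂ : ι'.obj X ⟶ (ι'.obj Y)⟦(1 : ℤ)⟧}
    (h₁ : SameExtension ι ι' δ δ₁) (h₂ : SameExtension ι ι' δ δ₂) : δ₁ = δ₂ := by
  simpa using SameExtension.comp_eq_comp_iff hι hι' h₁ h₂ (𝟙 Y) (𝟙 X)

/-- The morphism `ι' X ⟶ (ι' Y)⟦1⟧` classifying the same extension as a given morphism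
`ι X ⟶ (ι Y)⟦1⟧`. -/
noncomputable def mapExtension {X Y : A} (δ : ι.obj X ⟶ (ι.obj Y)⟦(1 : ℤ)⟧) :
    ι'.obj X ⟶ (ι'.obj Y)⟦(1 : ℤ)⟧ :=
  (exists_sameExtension hι hι' δ).choose

omit [ι'.Full] [ι'.Faithful] [ι'.Additive] in
lemma sameExtension_mapExtension {X Y : A} (δ : ι.obj X ⟶ (ι.obj Y)⟦(1 : ℤ)⟧) :
    SameExtension ι ι' δ (mapExtension hι hι' δ) :=
  (exists_sameExtension hι hι' δ).choose_spec

omit [ι'.Additive] in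
lemma map_comp_mapExtension {X₁ X₂ Y : A} (c : X₁ ⟶ X₂)
    (δ : ι.obj X₂ ⟶ (ι.obj Y)⟦(1 : ℤ)⟧) :
    mapExtension hι hι' (ι.map c ≫ δ) = ι'.map c ≫ mapExtension hι hι' δ := by
  simpa using SameExtension.comp_eq_comp_iff hι hι'
    (sameExtension_mapExtension hι hι' (ι.map c ≫ δ))
    (sameExtension_mapExtension hι hι' δ) (𝟙 Y) c

omit [ι'.Additive] in
lemma mapExtension_comp_map {X Y₁ Y₂ : A} (δ : ι.obj X ⟶ (ι.obj Y₁)⟦(1 : ℤ)⟧) (a : Y₁ ⟶ Y₂) :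
    mapExtension hι hι' (δ ≫ (ι.map a)⟦(1 : ℤ)⟧') =
      mapExtension hι hι' δ ≫ (ι'.map a)⟦(1 : ℤ)⟧' := by
  have h := (SameExtension.comp_eq_comp_iff hι hι' (sameExtension_mapExtension hι hι' δ)
    (sameExtension_mapExtension hι hι' (δ ≫ (ι.map a)⟦(1 : ℤ)⟧')) a (𝟙 X)).1 (by simp)
  simpa using h.symm

/-- Additivity follows from naturality, because the sum of `δ₁` and `δ₂` is obtained from the
morphism `(δ₁, δ₂) : ι X ⟶ (ι (Y ⊞ Y))⟦1⟧`. -/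
lemma mapExtension_add {X Y : A} (δ₁ δ₂ : ι.obj X ⟶ (ι.obj Y)⟦(1 : ℤ)⟧) :
    mapExtension hι hι' (δ₁ + δ₂) = mapExtension hι hι' δ₁ + mapExtension hι hι' δ₂ := by
  let ε : ι.obj X ⟶ (ι.obj (Y ⊞ Y))⟦(1 : ℤ)⟧ :=
    δ₁ ≫ (ι.map biprod.inl)⟦(1 : ℤ)⟧' + δ₂ ≫ (ι.map biprod.inr)⟦(1 : ℤ)⟧'
  have h₁ : ε ≫ (ι.map biprod.fst)⟦(1 : ℤ)⟧' = δ₁ := by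
    simp [ε, ← Functor.map_comp]
  have h₂ : ε ≫ (ι.map biprod.snd)⟦(1 : ℤ)⟧' = δ₂ := by
    simp [ε, ← Functor.map_comp]
  have h : δ₁ + δ₂ = ε ≫ (ι.map (biprod.fst + biprod.snd))⟦(1 : ℤ)⟧' := by
    rw [ι.map_add, Functor.map_add, Preadditive.comp_add, h₁, h₂]
  rw [h, mapExtension_comp_map, ι'.map_add, Functor.map_add, Preadditive.comp_add,
    ← mapExtension_comp_map, ← mapExtension_comp_map, h₁, h₂]

lemma mapExtension_mapExtension {X Y : A} (δ : ι.obj X ⟶ (ι.obj Y)⟦(1 : ℤ)⟧) :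
    mapExtension hι' hι (mapExtension hι hι' δ) = δ :=
  SameExtension.eq hι' hι (sameExtension_mapExtension hι' hι _)
    (sameExtension_mapExtension hι hι' δ).symm

/-- The additive bijection between morphisms of degree `1` given by the classification of
extensions. -/
noncomputable def extensionEquiv (X Y : A) :
    (ι.obj X ⟶ (ι.obj Y)⟦(1 : ℤ)⟧) ≃+ (ι'.obj X ⟶ (ι'.obj Y)⟦(1 : ℤ)⟧) where
  toFun := mapExtension hι hι'
  invFun := mapExtension hι' hι
  left_inv := mapExtension_mapExtension hι hι'
  right_inv := mapExtension_mapExtension hι' hι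
  map_add' := mapExtension_add hι hι'

section GradedIso

variable (hC : ∀ ⦃X Y : A⦄ ⦃n : ℤ⦄ (f : ι.obj X ⟶ (ι.obj Y)⟦n⟧), 2 ≤ n → f = 0)
  (hD : ∀ ⦃X Y : A⦄ ⦃n : ℤ⦄ (f : ι'.obj X ⟶ (ι'.obj Y)⟦n⟧), 2 ≤ n → f = 0)

omit [ι.Full] [ι.Faithful] [ι.Additive] in
include hι hC in
lemma hom_eq_zero_of_ne {X Y : A} {n : ℤ} (h₀ : n ≠ 0) (h₁ : n ≠ 1)
    (f : ι.obj X ⟶ (ι.obj Y)⟦n⟧) : f = 0 := by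
  rcases lt_or_ge n 0 with h | h
  · exact hι.hom_eq_zero f h
  · exact hC f (by lia)

/-- The action of `ι` on morphisms, as an additive bijection onto the morphisms of degree `0`. -/
noncomputable def mk₀Equiv (ι : A ⥤ C) [ι.Full] [ι.Faithful] [ι.Additive] (X Y : A) :
    (X ⟶ Y) ≃+ ShiftedHom (ι.obj X) (ι.obj Y) (0 : ℤ) :=
  AddEquiv.mk' (((Functor.FullyFaithful.ofFullyFaithful ι).homEquiv).trans
    (ShiftedHom.homEquiv (0 : ℤ) rfl)) (fun f g => by simp [Functor.FullyFaithful.homEquiv])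

omit [HasZeroObject C] [∀ n : ℤ, (shiftFunctor C n).Additive] [Pretriangulated C] in
lemma mk₀Equiv_apply {X Y : A} (f : X ⟶ Y) :
    mk₀Equiv ι X Y f = ShiftedHom.mk₀ (0 : ℤ) rfl (ι.map f) := rfl

open Classical in
/-- The bijections between the morphisms of each degree for two embeddings of a heart such that
there are nonzero morphisms in degrees `0` and `1` only. -/
noncomputable def degreeEquiv (X Y : A) (n : ℤ) :
    ShiftedHom (ι.obj X) (ι.obj Y) n ≃+ ShiftedHom (ι'.obj X) (ι'.obj Y) n :=
  if h₀ : n = 0 then by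
    subst h₀
    exact (mk₀Equiv ι X Y).symm.trans (mk₀Equiv ι' X Y)
  else if h₁ : n = 1 then by
    subst h₁
    exact extensionEquiv hι hι' X Y
  else
    { toFun := fun _ => 0
      invFun := fun _ => 0
      left_inv := fun f => (hom_eq_zero_of_ne hι hC h₀ h₁ f).symm
      right_inv := fun f => (hom_eq_zero_of_ne hι' hD h₀ h₁ f).symm
      map_add' := by simp }

lemma degreeEquiv_mk₀ {X Y : A} (f : X ⟶ Y) :
    degreeEquiv hι hι' hC hD X Y 0 (ShiftedHom.mk₀ 0 rfl (ι.map f)) =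
      ShiftedHom.mk₀ 0 rfl (ι'.map f) := by
  rw [← mk₀Equiv_apply, ← mk₀Equiv_apply]
  simp [degreeEquiv]

lemma degreeEquiv_one {X Y : A} (δ : ι.obj X ⟶ (ι.obj Y)⟦(1 : ℤ)⟧) :
    degreeEquiv hι hι' hC hD X Y 1 δ = mapExtension hι hι' δ := by
  simp [degreeEquiv, extensionEquiv]

/-- Two embeddings of a heart for which there are nonzero morphisms in degrees `0` and `1` only
have isomorphic graded categories of morphisms. -/
noncomputable def gradedIso : GradedIso ι ι' where
  equiv := degreeEquiv hι hι' hC hD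
  equiv_mk₀ := degreeEquiv_mk₀ hι hι' hC hD
  equiv_comp {X Y Z a b c} f g h := by
    by_cases ha₀ : a = 0
    · subst ha₀
      obtain rfl : b = c := by lia
      obtain ⟨f, rfl⟩ := (mk₀Equiv ι X Y).surjective f
      rw [mk₀Equiv_apply, degreeEquiv_mk₀, ShiftedHom.mk₀_comp, ShiftedHom.mk₀_comp]
      by_cases hb₀ : b = 0
      · subst hb₀
        obtain ⟨g, rfl⟩ := (mk₀Equiv ι Y Z).surjective g
        rw [mk₀Equiv_apply, degreeEquiv_mk₀]
        have h₁ : ι.map f ≫ ShiftedHom.mk₀ (0 : ℤ) rfl (ι.map g) =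
            ShiftedHom.mk₀ (0 : ℤ) rfl (ι.map (f ≫ g)) := by
          simp [ShiftedHom.mk₀]
        have h₂ : ι'.map f ≫ ShiftedHom.mk₀ (0 : ℤ) rfl (ι'.map g) =
            ShiftedHom.mk₀ (0 : ℤ) rfl (ι'.map (f ≫ g)) := by
          simp [ShiftedHom.mk₀]
        rw [h₁, h₂, degreeEquiv_mk₀]
      by_cases hb₁ : b = 1
      · subst hb₁
        rw [degreeEquiv_one, degreeEquiv_one, map_comp_mapExtension]
      · rw [hom_eq_zero_of_ne hι hC hb₀ hb₁ g, comp_zero, map_zero, map_zero, comp_zero]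
    by_cases ha₁ : a = 1
    · subst ha₁
      by_cases hb₀ : b = 0
      · subst hb₀
        obtain rfl : c = 1 := by lia
        obtain ⟨g, rfl⟩ := (mk₀Equiv ι Y Z).surjective g
        rw [mk₀Equiv_apply, degreeEquiv_mk₀, ShiftedHom.comp_mk₀, ShiftedHom.comp_mk₀,
          degreeEquiv_one, degreeEquiv_one, mapExtension_comp_map]
      by_cases hb₁ : b = 1
      · exact (hD _ (by lia)).trans (hD _ (by lia)).symm
      · rw [hom_eq_zero_of_ne hι hC hb₀ hb₁ g, ShiftedHom.comp_zero, map_zero, map_zero,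
          ShiftedHom.comp_zero]
    · rw [hom_eq_zero_of_ne hι hC ha₀ ha₁ f, ShiftedHom.zero_comp, map_zero, map_zero,
        ShiftedHom.zero_comp]

end GradedIso

end IsHeartEmbedding

end HeartEmbedding

/-! ### The heart of a t-structure -/

lemma distinguished_of_iso {C : Type*} [Category* C] [Preadditive C] [HasZeroObject C]
    [HasShift C ℤ] [∀ n : ℤ, (shiftFunctor C n).Additive] [Pretriangulated C]
    {X Y Z X' Y' Z' : C} {f : X ⟶ Y} {g : Y ⟶ Z} {h : Z ⟶ X⟦(1 : ℤ)⟧} {f' : X' ⟶ Y'}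
    {g' : Y' ⟶ Z'} {h' : Z' ⟶ X'⟦(1 : ℤ)⟧} (hT : Triangle.mk f g h ∈ distTriang C)
    (e₁ : X' ≅ X) (e₂ : Y' ≅ Y) (e₃ : Z' ≅ Z) (comm₁ : f' ≫ e₂.hom = e₁.hom ≫ f)
    (comm₂ : g' ≫ e₃.hom = e₂.hom ≫ g) (comm₃ : h' ≫ e₁.hom⟦(1 : ℤ)⟧' = e₃.hom ≫ h) :
    Triangle.mk f' g' h' ∈ distTriang C :=
  isomorphic_distinguished _ hT _ (Triangle.isoMk _ _ e₁ e₂ e₃ comm₁ comm₂ comm₃)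

section Amplitude

variable {C : Type*} [Category* C] [Preadditive C] [HasZeroObject C] [HasShift C ℤ]
  [∀ n : ℤ, (shiftFunctor C n).Additive] [Pretriangulated C]
  (t : TStructure C) {X Y Z : C} {f : X ⟶ Y} {g : Y ⟶ Z} {h : Z ⟶ X⟦(1 : ℤ)⟧}
  (hT : Triangle.mk f g h ∈ distTriang C) (n m : ℤ)

include hT

lemma isLE_of_distTriang_mor₃ (hX : t.IsLE X m) (hY : t.IsLE Y n) (hm : m ≤ n + 1) :
    t.IsLE Z n :=
  t.isLE₂ _ (rot_of_distTriang _ hT) n hY (by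
    have := t.isLE_shift X m 1 (m - 1) (by lia)
    exact t.isLE_of_le (X⟦(1 : ℤ)⟧) (m - 1) n (by lia))

lemma isGE_of_distTriang_mor₃ (hX : t.IsGE X m) (hY : t.IsGE Y n) (hm : n + 1 ≤ m) :
    t.IsGE Z n :=
  t.isGE₂ _ (rot_of_distTriang _ hT) n hY (by
    have := t.isGE_shift X m 1 (m - 1) (by lia)
    exact t.isGE_of_ge (X⟦(1 : ℤ)⟧) n (m - 1) (by lia))

lemma isGE_of_distTriang_mor₁ (hY : t.IsGE Y n) (hZ : t.IsGE Z m) (hm : n ≤ m + 1) :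
    t.IsGE X n :=
  t.isGE₂ _ (inv_rot_of_distTriang _ hT) n (by
    have := t.isGE_shift Z m (-1) (m + 1) (by lia)
    exact t.isGE_of_ge (Z⟦(-1 : ℤ)⟧) n (m + 1) (by lia)) hY

end Amplitude

section Heart

variable {A : Type*} [Category* A]
  {C : Type*} [Category* C] [Preadditive C] [HasZeroObject C] [HasShift C ℤ]
  [∀ n : ℤ, (shiftFunctor C n).Additive] [Pretriangulated C]
  (t : TStructure C) {ι : A ⥤ C} (hι : ι.essImage = t.heart)

include hι

lemma isLE_of_essImage_eq_heart (X : A) : t.IsLE (ι.obj X) 0 := by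
  have h : t.heart (ι.obj X) := by
    rw [← hι]
    exact ι.obj_mem_essImage X
  exact ((t.mem_heart_iff _).1 h).1

lemma isGE_of_essImage_eq_heart (X : A) : t.IsGE (ι.obj X) 0 := by
  have h : t.heart (ι.obj X) := by
    rw [← hι]
    exact ι.obj_mem_essImage X
  exact ((t.mem_heart_iff _).1 h).2

lemma exists_iso_of_isLE_of_isGE (Z : C) (h₁ : t.IsLE Z 0) (h₂ : t.IsGE Z 0) :
    ∃ X : A, Nonempty (ι.obj X ≅ Z) := by
  have h : t.heart Z := (t.mem_heart_iff _).2 ⟨h₁, h₂⟩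
  rw [← hι] at h
  exact h

lemma hom_eq_zero_of_neg ⦃X Y : A⦄ ⦃n : ℤ⦄ (f : ι.obj X ⟶ (ι.obj Y)⟦n⟧) (hn : n < 0) :
    f = 0 := by
  have := isLE_of_essImage_eq_heart t hι X
  have := isGE_of_essImage_eq_heart t hι Y
  have : t.IsGE ((ι.obj Y)⟦n⟧) (-n) := t.isGE_shift _ 0 n (-n) (by lia)
  exact t.zero f 0 (-n) (by lia)

lemma exists_triangle_of_hom [ι.Full] {X Y : A} (δ : ι.obj X ⟶ (ι.obj Y)⟦(1 : ℤ)⟧) :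
    ∃ (E : A) (i : Y ⟶ E) (p : E ⟶ X), Triangle.mk (ι.map i) (ι.map p) δ ∈ distTriang C := by
  obtain ⟨Z, f, g, hT⟩ := distinguished_cocone_triangle₂ δ
  obtain ⟨E, ⟨e⟩⟩ := exists_iso_of_isLE_of_isGE t hι Z
    (t.isLE₂ _ hT 0 (isLE_of_essImage_eq_heart t hι Y) (isLE_of_essImage_eq_heart t hι X))
    (t.isGE₂ _ hT 0 (isGE_of_essImage_eq_heart t hι Y) (isGE_of_essImage_eq_heart t hι X))
  obtain ⟨i, hi⟩ := ι.map_surjective (f ≫ e.inv)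
  obtain ⟨p, hp⟩ := ι.map_surjective (e.hom ≫ g)
  refine ⟨E, i, p, distinguished_of_iso hT (Iso.refl _) e (Iso.refl _) ?_ ?_ ?_⟩
  · simp [hi]
  · simp [hp]
  · simp

/-- The cone of a morphism in the heart is an extension of the cokernel by the shift of the
kernel, which are obtained by truncation. -/
lemma admissibleMorphism_eq_top :
    AbelianSubcategory.admissibleMorphism ι = ⊤ := by
  ext X₁ X₂ f₁
  simp only [MorphismProperty.top_apply, iff_true]
  intro X₃ f₂ f₃ hT
  have hX₁ := isLE_of_essImage_eq_heart t hι X₁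
  have hX₂ := isLE_of_essImage_eq_heart t hι X₂
  have hX₁' := isGE_of_essImage_eq_heart t hι X₁
  have hX₂' := isGE_of_essImage_eq_heart t hι X₂
  have h₃ : t.IsLE X₃ 0 := isLE_of_distTriang_mor₃ t hT 0 0 hX₁ hX₂ (by lia)
  have h₃' : t.IsGE X₃ (-1) := isGE_of_distTriang_mor₃ t hT (-1) 0 hX₁'
    (t.isGE_of_ge _ (-1) 0 (by lia)) (by lia)
  obtain ⟨U, V, hU, hV, α, β, γ, hT'⟩ := t.exists_triangle X₃ (-1) 0 (by lia)
  replace hU : t.IsLE U (-1) := ⟨hU⟩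
  replace hV : t.IsGE V 0 := ⟨hV⟩
  have hV' : t.IsLE V 0 := isLE_of_distTriang_mor₃ t hT' 0 (-1) hU h₃ (by lia)
  have hU' : t.IsGE U (-1) := isGE_of_distTriang_mor₁ t hT' (-1) 0 h₃' hV (by lia)
  obtain ⟨K, ⟨k⟩⟩ := exists_iso_of_isLE_of_isGE t hι (U⟦(-1 : ℤ)⟧)
    (t.isLE_shift U (-1) (-1) 0 (by lia)) (t.isGE_shift U (-1) (-1) 0 (by lia))
  obtain ⟨Q, ⟨q⟩⟩ := exists_iso_of_isLE_of_isGE t hι V hV' hV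
  let k' : (ι.obj K)⟦(1 : ℤ)⟧ ≅ U :=
    (shiftFunctor C (1 : ℤ)).mapIso k ≪≫ (shiftEquiv C (1 : ℤ)).counitIso.app U
  refine ⟨K, Q, k'.hom ≫ α, β ≫ q.inv, q.hom ≫ γ ≫ k'.inv⟦(1 : ℤ)⟧',
    distinguished_of_iso hT' k' (Iso.refl _) q ?_ ?_ ?_⟩
  · simp
  · simp
  · simp [← Functor.map_comp]

/-- The embedding of the heart of a t-structure satisfies `IsHeartEmbedding`. The triangle of a
short exact sequence is obtained from the description of kernels of epimorphisms by triangles. -/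
lemma isHeartEmbedding_of_essImage_eq_heart [Abelian A] [ι.Full] [ι.Faithful] [ι.Additive] :
    IsHeartEmbedding ι where
  hom_eq_zero := hom_eq_zero_of_neg t hι
  exists_triangle_of_hom _ _ := exists_triangle_of_hom t hι
  exists_triangle_of_shortExact S hS := by
    have hneg := hom_eq_zero_of_neg t hι
    have := hS.epi_g
    obtain ⟨K, i, δ, hT⟩ := AbelianSubcategory.exists_distinguished_triangle_of_epi hneg
      (admissibleMorphism_eq_top t hι) S.g
    have hK := AbelianSubcategory.isLimitKernelForkOfDistTriang hneg i S.g δ hT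
    let e : S.X₁ ≅ K := IsLimit.conePointUniqueUpToIso hS.fIsKernel hK
    have he : e.hom ≫ i = S.f :=
      IsLimit.conePointUniqueUpToIso_hom_comp hS.fIsKernel hK WalkingParallelPair.zero
    refine ⟨δ ≫ (ι.map e.inv)⟦(1 : ℤ)⟧', distinguished_of_iso hT (ι.mapIso e) (Iso.refl _)
      (Iso.refl _) ?_ ?_ ?_⟩
    · simp [← he]
    · simp
    · simp [← Functor.map_comp]

end Heart

/-! ### Decomposition of bounded objects -/

section Decomposition

variable {D : Type u} [Category.{v} D] [Preadditive D] [HasZeroObject D] [HasShift D ℤ]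
  [∀ n : ℤ, (shiftFunctor D n).Additive] [Pretriangulated D]

omit [Preadditive D] [HasZeroObject D] [∀ n : ℤ, (shiftFunctor D n).Additive]
  [Pretriangulated D] in
lemma prop_iSup_map_shift_iff (P : ObjectProperty D) (X : D) :
    (⨆ n : ℤ, P.map (shiftFunctor D n)) X ↔
      ∃ (n : ℤ) (Y : D), P Y ∧ Nonempty (Y⟦n⟧ ≅ X) := by
  simp [ObjectProperty.prop_map_iff]

/-- The vanishing assumption on the heart, restated for objects concentrated in single degrees `c`
and `d` with `d ≤ c - 2`. -/
lemma hom_eq_zero_of_pure (t : TStructure D)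
    (ht : ∀ (X Y : D), t.heart X → t.heart Y → ∀ n : ℤ, 2 ≤ n → ∀ f : X ⟶ Y⟦n⟧, f = 0)
    {U W : D} (c d : ℤ) (hU : t.IsLE U c) (hU' : t.IsGE U c) (hW : t.IsLE W d)
    (hW' : t.IsGE W d) (h : d ≤ c - 2) (f : U ⟶ W) : f = 0 := by
  apply (shiftFunctor D c).map_injective
  rw [Functor.map_zero, ← cancel_mono ((shiftFunctorAdd' D d (c - d) c (by lia)).hom.app W),
    zero_comp]
  exact ht _ _
    ((t.mem_heart_iff _).2 ⟨t.isLE_shift U c c 0 (by lia), t.isGE_shift U c c 0 (by lia)⟩)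
    ((t.mem_heart_iff _).2 ⟨t.isLE_shift W d d 0 (by lia), t.isGE_shift W d d 0 (by lia)⟩)
    _ (by lia) _

/-- If there are no morphisms of degree `≥ 2` between objects of the heart, the truncation
triangles split, so that bounded objects are direct sums of shifts of objects of the heart. -/
lemma addClosure_of_bounded (t : TStructure D)
    (ht : ∀ (X Y : D), t.heart X → t.heart Y → ∀ n : ℤ, 2 ≤ n → ∀ f : X ⟶ Y⟦n⟧, f = 0)
    (X : D) (hX : t.bounded X) :
    addClosure (⨆ n : ℤ, t.heart.map (shiftFunctor D n)) X := by
  -- the amplitude is at most `k`; the second assertion makes the truncation triangles split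
  have key (k : ℕ) : ∀ (a : ℤ) (X : D), t.IsGE X a → t.IsLE X (a + k - 1) →
      addClosure (⨆ n : ℤ, t.heart.map (shiftFunctor D n)) X ∧
      ∀ (W : D) (d : ℤ), d ≤ a - 2 → t.IsLE W d → t.IsGE W d → ∀ f : X ⟶ W, f = 0 := by
    induction k with
    | zero =>
      intro a X h₁ h₂
      have hX : IsZero X := t.isZero X (a + (0 : ℕ) - 1) a (by simp)
      exact ⟨.of_isZero X hX, fun _ _ _ _ _ _ => hX.eq_of_src _ _⟩
    | succ k hk =>
      intro a X h₁ h₂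
      obtain ⟨U, V, hU, hV, α, β, γ, hT⟩ := t.exists_triangle X a (a + 1) rfl
      replace hU : t.IsLE U a := ⟨hU⟩
      replace hV : t.IsGE V (a + 1) := ⟨hV⟩
      have hU' : t.IsGE U a := isGE_of_distTriang_mor₁ t hT a (a + 1) h₁ hV (by lia)
      have h₂' : t.IsLE X (a + 1 + k - 1) :=
        t.isLE_of_le _ (a + (k + 1 : ℕ) - 1) _ (by push_cast; lia)
      have hV' : t.IsLE V (a + 1 + k - 1) := isLE_of_distTriang_mor₃ t hT _ a hU h₂' (by lia)
      obtain ⟨hV₁, hV₂⟩ := hk (a + 1) V hV hV'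
      constructor
      · have hγ : γ = 0 := hV₂ _ (a - 1) (by lia) (t.isLE_shift U a 1 (a - 1) (by lia))
          (t.isGE_shift U a 1 (a - 1) (by lia)) γ
        obtain ⟨e, -, -⟩ := exists_iso_binaryBiproduct_of_distTriang _ hT hγ
        refine .of_iso _ _ e.symm (.biprod _ _ (.of_mem _ ?_) hV₁)
        exact (prop_iSup_map_shift_iff _ _).2 ⟨-a, U⟦a⟧, (t.mem_heart_iff _).2
          ⟨t.isLE_shift U a a 0 (by lia), t.isGE_shift U a a 0 (by lia)⟩,
          ⟨(shiftEquiv D a).unitIso.symm.app U⟩⟩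
      · intro W d hd hW hW' f
        obtain ⟨g, rfl⟩ := Triangle.yoneda_exact₂ _ hT f
          (hom_eq_zero_of_pure t ht a d hU hU' hW hW' hd _)
        obtain rfl : g = 0 := hV₂ W d (by lia) hW hW' g
        exact comp_zero
  obtain ⟨⟨a, ha⟩, ⟨b, hb⟩⟩ := hX
  exact (key (b + 1 - a).toNat a X ha (t.isLE_of_le X b _ (by lia))).1

end Decomposition

/-! ### The t-structure generated by a subcategory without negative morphisms -/

section AddClosure

variable {D : Type u} [Category.{v} D] [Preadditive D] [HasZeroObject D] [HasShift D ℤ]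
  [∀ n : ℤ, (shiftFunctor D n).Additive] [Pretriangulated D]

lemma addClosure_mono {S S' : ObjectProperty D} (h : S ≤ S') {X : D} (hX : addClosure S X) :
    addClosure S' X := by
  induction hX with
  | of_mem X hX => exact .of_mem X (h X hX)
  | of_isZero X hX => exact .of_isZero X hX
  | biprod X Y _ _ hX hY => exact .biprod X Y hX hY
  | of_iso X Y e _ hX => exact .of_iso X Y e hX

/-- The image of an object of `addClosure S` by an additive functor. -/
lemma addClosure_obj {S S' : ObjectProperty D} (F : D ⥤ D) [F.Additive]
    (h : ∀ X, S X → S' (F.obj X)) {X : D} (hX : addClosure S X) :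
    addClosure S' (F.obj X) := by
  have := preservesBinaryBiproducts_of_preservesBiproducts F
  induction hX with
  | of_mem X hX => exact .of_mem _ (h X hX)
  | of_isZero X hX => exact .of_isZero _ (F.map_isZero hX)
  | biprod X Y _ _ hX hY => exact .of_iso _ _ (F.mapBiprod X Y).symm (.biprod _ _ hX hY)
  | of_iso X Y e _ hX => exact .of_iso _ _ (F.mapIso e) hX

lemma addClosure_hom_eq_zero {S S' : ObjectProperty D}
    (h : ∀ X Y, S X → S' Y → ∀ f : X ⟶ Y, f = 0) {X Y : D} (hX : addClosure S X)
    (hY : addClosure S' Y) (f : X ⟶ Y) : f = 0 := by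
  induction hX with
  | of_mem X hX =>
    induction hY with
    | of_mem Y hY => exact h X Y hX hY f
    | of_isZero Y hY => exact hY.eq_of_tgt _ _
    | biprod Y₁ Y₂ _ _ h₁ h₂ =>
      apply biprod.hom_ext
      · rw [h₁ (f ≫ biprod.fst), zero_comp]
      · rw [h₂ (f ≫ biprod.snd), zero_comp]
    | of_iso Y Y' e _ h => rw [← cancel_mono e.inv, h (f ≫ e.inv), zero_comp]
  | of_isZero X hX => exact hX.eq_of_src _ _
  | biprod X₁ X₂ _ _ h₁ h₂ =>
    apply biprod.hom_ext'
    · rw [h₁ (biprod.inl ≫ f), comp_zero]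
    · rw [h₂ (biprod.inr ≫ f), comp_zero]
  | of_iso X X' e _ h => rw [← cancel_epi e.hom, h (e.hom ≫ f), comp_zero]

/-- If `S` is the union of two classes of objects, the summands of an object of `add S` can be
gathered accordingly. -/
lemma addClosure_exists_iso_biprod {S S₁ S₂ : ObjectProperty D} (h : ∀ X, S X → S₁ X ∨ S₂ X)
    {X : D} (hX : addClosure S X) :
    ∃ (X₁ X₂ : D), addClosure S₁ X₁ ∧ addClosure S₂ X₂ ∧ Nonempty (X ≅ X₁ ⊞ X₂) := by
  obtain ⟨Z, hZ⟩ := HasZeroObject.zero (C := D)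
  induction hX with
  | of_mem X hX =>
    rcases h X hX with h' | h'
    · exact ⟨X, Z, .of_mem X h', .of_isZero _ hZ, ⟨isoBiprodZero hZ⟩⟩
    · exact ⟨Z, X, .of_isZero _ hZ, .of_mem X h', ⟨isoZeroBiprod hZ⟩⟩
  | of_isZero X hX =>
    exact ⟨X, X, .of_isZero X hX, .of_isZero X hX, ⟨isoBiprodZero hX⟩⟩
  | biprod X Y _ _ hX hY =>
    obtain ⟨X₁, X₂, hX₁, hX₂, ⟨e⟩⟩ := hX
    obtain ⟨Y₁, Y₂, hY₁, hY₂, ⟨e'⟩⟩ := hY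
    refine ⟨X₁ ⊞ Y₁, X₂ ⊞ Y₂, .biprod _ _ hX₁ hY₁, .biprod _ _ hX₂ hY₂,
      ⟨biprod.mapIso e e' ≪≫ ?_⟩⟩
    exact
      { hom := biprod.lift (biprod.map biprod.fst biprod.fst) (biprod.map biprod.snd biprod.snd)
        inv := biprod.lift (biprod.map biprod.fst biprod.fst) (biprod.map biprod.snd biprod.snd) }
  | of_iso X Y e _ hX =>
    obtain ⟨X₁, X₂, hX₁, hX₂, ⟨e'⟩⟩ := hX
    exact ⟨X₁, X₂, hX₁, hX₂, ⟨e.symm ≪≫ e'⟩⟩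

end AddClosure

section TStructure

variable {D : Type u} [Category.{v} D] [Preadditive D] [HasZeroObject D] [HasShift D ℤ]
  [∀ n : ℤ, (shiftFunctor D n).Additive] [Pretriangulated D] (P : ObjectProperty D)

/-- The objects which are isomorphic to `Y⟦n⟧` for some object `Y` satisfying `P` and some
`n ∈ I`. -/
def shiftsIn (I : Set ℤ) : ObjectProperty D :=
  fun X => ∃ n ∈ I, ∃ Y, P Y ∧ Nonempty (Y⟦n⟧ ≅ X)

variable {P}

omit [Preadditive D] [HasZeroObject D] [∀ n : ℤ, (shiftFunctor D n).Additive]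
  [Pretriangulated D] in
lemma shiftsIn_mono {I I' : Set ℤ} (h : I ⊆ I') : shiftsIn P I ≤ shiftsIn P I' := by
  rintro X ⟨n, hn, Y, hY, e⟩
  exact ⟨n, h hn, Y, hY, e⟩

lemma addClosure_shiftsIn_shift {I I' : Set ℤ} (a : ℤ) (h : ∀ n ∈ I, n + a ∈ I') {X : D}
    (hX : addClosure (shiftsIn P I) X) : addClosure (shiftsIn P I') (X⟦a⟧) := by
  refine addClosure_obj (shiftFunctor D a) ?_ hX
  rintro X ⟨n, hn, Y, hY, ⟨e⟩⟩
  exact ⟨n + a, h n hn, Y, hY,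
    ⟨(shiftFunctorAdd' D n a _ rfl).app Y ≪≫ (shiftFunctor D a).mapIso e⟩⟩

lemma addClosure_shiftsIn_exists_iso_biprod {I I₁ I₂ : Set ℤ} (h : I ⊆ I₁ ∪ I₂) {X : D}
    (hX : addClosure (shiftsIn P I) X) :
    ∃ (X₁ X₂ : D), addClosure (shiftsIn P I₁) X₁ ∧ addClosure (shiftsIn P I₂) X₂ ∧
      Nonempty (X ≅ X₁ ⊞ X₂) := by
  refine addClosure_exists_iso_biprod ?_ hX
  rintro X ⟨n, hn, hX⟩
  exact (h hn).imp (fun h' => ⟨n, h', hX⟩) (fun h' => ⟨n, h', hX⟩)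

/-- As `P` is closed under finite biproducts, the objects of `add P` lie in `P` up to
isomorphism. -/
lemma exists_iso_of_addClosure_shiftsIn_zero [HasFiniteBiproducts P.FullSubcategory] {X : D}
    (hX : addClosure (shiftsIn P {0}) X) : P.isoClosure X := by
  have := hasBinaryBiproducts_of_finite_biproducts P.FullSubcategory
  have := preservesBinaryBiproducts_of_preservesBiproducts P.ι
  induction hX with
  | of_mem X hX =>
    obtain ⟨n, hn, Y, hY, ⟨e⟩⟩ := hX
    obtain rfl : n = 0 := hn
    exact ⟨Y, hY, ⟨e.symm ≪≫ (shiftFunctorZero D ℤ).app Y⟩⟩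
  | of_isZero X hX =>
    have := hasZeroObject_of_hasFiniteBiproducts P.FullSubcategory
    obtain ⟨Z, hZ⟩ := HasZeroObject.zero (C := P.FullSubcategory)
    exact ⟨Z.obj, Z.property, ⟨hX.iso (P.ι.map_isZero hZ)⟩⟩
  | biprod X Y _ _ hX hY =>
    obtain ⟨X', hX', ⟨e⟩⟩ := hX
    obtain ⟨Y', hY', ⟨e'⟩⟩ := hY
    let U : P.FullSubcategory := ⟨X', hX'⟩
    let V : P.FullSubcategory := ⟨Y', hY'⟩
    exact ⟨(U ⊞ V).obj, (U ⊞ V).property,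
      ⟨biprod.mapIso e e' ≪≫ (P.ι.mapBiprod U V).symm⟩⟩
  | of_iso X Y e _ hX =>
    obtain ⟨X', hX', ⟨e'⟩⟩ := hX
    exact ⟨X', hX', ⟨e.symm ≪≫ e'⟩⟩

variable (hP : ∀ X Y : D, P X → P Y → ∀ m : ℤ, m < 0 → ∀ f : X ⟶ Y⟦m⟧, f = 0)

include hP in
lemma hom_shiftsIn_eq_zero {I I' : Set ℤ} (h : ∀ i ∈ I, ∀ j ∈ I', j < i) {X Y : D}
    (hX : addClosure (shiftsIn P I) X) (hY : addClosure (shiftsIn P I') Y) (f : X ⟶ Y) :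
    f = 0 := by
  refine addClosure_hom_eq_zero ?_ hX hY f
  rintro X Y ⟨i, hi, U, hU, ⟨e⟩⟩ ⟨j, hj, V, hV, ⟨e'⟩⟩ f
  have hij := h i hi j hj
  obtain ⟨g, hg⟩ := (shiftedHomUpEquiv U V (j - i) i j (by lia)).surjective (e.hom ≫ f ≫ e'.inv)
  rw [hP U V hU hV (j - i) (by lia) g, map_zero] at hg
  rw [← cancel_epi e.hom, ← cancel_mono e'.inv, Category.assoc, ← hg]
  simp

variable (hgen : ∀ X : D, addClosure (shiftsIn P Set.univ) X)

/-- The t-structure whose heart is `P` up to isomorphism, attached to a subcategory `P` which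
generates `D` and has no nonzero morphisms of negative degree. -/
def generatedTStructure : TStructure D where
  le k := addClosure (shiftsIn P (Set.Ici (-k)))
  ge k := addClosure (shiftsIn P (Set.Iic (-k)))
  le_isClosedUnderIsomorphisms k := ⟨fun e hX => .of_iso _ _ e hX⟩
  ge_isClosedUnderIsomorphisms k := ⟨fun e hX => .of_iso _ _ e hX⟩
  le_shift n a n' h X hX := addClosure_shiftsIn_shift a
    (fun i hi => by simp only [Set.mem_Ici] at hi ⊢; lia) hX
  ge_shift n a n' h X hX := addClosure_shiftsIn_shift a
    (fun i hi => by simp only [Set.mem_Iic] at hi ⊢; lia) hX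
  zero' X Y f hX hY := hom_shiftsIn_eq_zero hP
    (fun i hi j hj => by simp only [Set.mem_Iic, Set.mem_Ici] at hi hj; lia) hX hY f
  le_zero_le X hX := addClosure_mono (shiftsIn_mono (Set.Ici_subset_Ici.2 (by lia))) hX
  ge_one_le X hX := addClosure_mono (shiftsIn_mono (Set.Iic_subset_Iic.2 (by lia))) hX
  exists_triangle_zero_one X := by
    obtain ⟨X₁, X₂, h₁, h₂, ⟨e⟩⟩ := addClosure_shiftsIn_exists_iso_biprod
      (I₁ := Set.Ici (-0)) (I₂ := Set.Iic (-1)) (fun i _ => by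
        simp only [Set.mem_union, Set.mem_Iic, Set.mem_Ici]; lia) (hgen X)
    exact ⟨X₁, X₂, h₁, h₂, biprod.inl ≫ e.inv, e.hom ≫ biprod.snd, 0,
      distinguished_of_iso (binaryBiproductTriangle_distinguished X₁ X₂) (Iso.refl _) e
        (Iso.refl _) (by simp) (by simp) (by simp)⟩

lemma generatedTStructure_heart [HasFiniteBiproducts P.FullSubcategory] :
    (generatedTStructure hP hgen).heart = P.isoClosure := by
  ext X
  constructor
  · rintro ⟨h₁, h₂⟩
    obtain ⟨X₁, X₂, hX₁, hX₂, ⟨e⟩⟩ := addClosure_shiftsIn_exists_iso_biprod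
      (I₁ := {0}) (I₂ := Set.Ici 1) (fun i hi => by
        simp only [Set.mem_union, Set.mem_singleton_iff, Set.mem_Ici] at hi ⊢; lia) h₁
    -- the summand in negative cohomological degrees vanishes because it maps to `X` by zero
    have h₀ : biprod.inr ≫ e.inv = 0 := hom_shiftsIn_eq_zero hP
      (fun i hi j hj => by simp only [Set.mem_Iic, Set.mem_Ici] at hi hj; lia) hX₂ h₂ _
    have hX₂' : IsZero X₂ := by
      rw [IsZero.iff_id_eq_zero]
      calc 𝟙 X₂ = (biprod.inr ≫ e.inv) ≫ e.hom ≫ biprod.snd := by simp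
        _ = 0 := by rw [h₀, zero_comp]
    obtain ⟨Y, hY, ⟨e'⟩⟩ := exists_iso_of_addClosure_shiftsIn_zero hX₁
    exact ⟨Y, hY, ⟨e ≪≫ (isoBiprodZero hX₂').symm ≪≫ e'⟩⟩
  · rintro ⟨Y, hY, ⟨e⟩⟩
    have h : shiftsIn P {0} X := ⟨0, rfl, Y, hY, ⟨(shiftFunctorZero D ℤ).app Y ≪≫ e.symm⟩⟩
    exact ⟨.of_mem _ (shiftsIn_mono (by simp) _ h), .of_mem _ (shiftsIn_mono (by simp) _ h)⟩

lemma generatedTStructure_bounded (X : D) : (generatedTStructure hP hgen).bounded X := by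
  have key : ∃ k : ℕ, addClosure (shiftsIn P (Set.Icc (-k : ℤ) k)) X := by
    have hmono (k l : ℕ) (h : k ≤ l) :
        shiftsIn P (Set.Icc (-k : ℤ) k) ≤ shiftsIn P (Set.Icc (-l : ℤ) l) :=
      shiftsIn_mono (Set.Icc_subset_Icc (by lia) (by lia))
    induction hgen X with
    | of_mem X hX =>
      obtain ⟨n, -, Y, hY, ⟨e⟩⟩ := hX
      exact ⟨n.natAbs, .of_mem _ ⟨n, ⟨by lia, by lia⟩, Y, hY, ⟨e⟩⟩⟩
    | of_isZero X hX => exact ⟨0, .of_isZero X hX⟩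
    | biprod X Y _ _ hX hY =>
      obtain ⟨k, hk⟩ := hX
      obtain ⟨l, hl⟩ := hY
      exact ⟨max k l, .biprod _ _ (addClosure_mono (hmono _ _ (le_max_left _ _)) hk)
        (addClosure_mono (hmono _ _ (le_max_right _ _)) hl)⟩
    | of_iso X Y e _ hX =>
      obtain ⟨k, hk⟩ := hX
      exact ⟨k, .of_iso _ _ e hk⟩
  obtain ⟨k, hk⟩ := key
  refine ⟨⟨-k, ⟨addClosure_mono (shiftsIn_mono ?_) hk⟩⟩,
    ⟨k, ⟨addClosure_mono (shiftsIn_mono ?_) hk⟩⟩⟩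
  · intro i hi
    simpa using hi.2
  · intro i hi
    exact hi.1

include hP hgen in
/-- A morphism of degree `n ≥ 2` between objects of `P` vanishes, because its cone `W` is a direct
sum of shifts of objects of `P`. Indeed `W ≅ W₁ ⊞ W₂` where `W₁` gathers the shifts by at least
`2`; then `Y⟦n⟧ ⟶ W` factors through `W₁`, and `W₁ ⟶ W` factors through `Y⟦n⟧`, so that
`Y⟦n⟧ ⟶ W` is a split monomorphism. -/
lemma hom_eq_zero_of_two_le {X Y : D} (hX : P X) (hY : P Y) (n : ℤ) (hn : 2 ≤ n)
    (f : X ⟶ Y⟦n⟧) : f = 0 := by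
  obtain ⟨W, a, g, hT⟩ := distinguished_cocone_triangle f
  obtain ⟨W₁, W₂, h₁, h₂, ⟨e⟩⟩ := addClosure_shiftsIn_exists_iso_biprod
    (I₁ := Set.Ici 2) (I₂ := Set.Iic 1) (fun i _ => by
      simp only [Set.mem_union, Set.mem_Iic, Set.mem_Ici]; lia) (hgen W)
  have hX₀ : addClosure (shiftsIn P {0}) X :=
    .of_mem _ ⟨0, rfl, X, hX, ⟨(shiftFunctorZero D ℤ).app X⟩⟩
  have hX₁ : addClosure (shiftsIn P {1}) (X⟦(1 : ℤ)⟧) :=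
    .of_mem _ ⟨1, rfl, X, hX, ⟨Iso.refl _⟩⟩
  have hYn : addClosure (shiftsIn P {n}) (Y⟦n⟧) :=
    .of_mem _ ⟨n, rfl, Y, hY, ⟨Iso.refl _⟩⟩
  have z₁ : (biprod.inl ≫ e.inv) ≫ g = 0 := hom_shiftsIn_eq_zero hP
    (fun i hi j hj => by simp only [Set.mem_singleton_iff, Set.mem_Ici] at hi hj; lia) h₁ hX₁ _
  have z₂ : a ≫ e.hom ≫ biprod.snd = 0 := hom_shiftsIn_eq_zero hP
    (fun i hi j hj => by simp only [Set.mem_singleton_iff, Set.mem_Iic] at hi hj; lia) hYn h₂ _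
  obtain ⟨s, hs⟩ := Triangle.coyoneda_exact₃ _ hT (biprod.inl ≫ e.inv) z₁
  change W₁ ⟶ Y⟦n⟧ at s
  replace hs : biprod.inl ≫ e.inv = s ≫ a := hs
  have ha : a = (a ≫ e.hom ≫ biprod.fst) ≫ s ≫ a := by
    rw [← hs, ← cancel_mono e.hom]
    apply biprod.hom_ext
    · simp
    · simpa using z₂
  obtain ⟨r, hr⟩ := Triangle.coyoneda_exact₂ _ hT (𝟙 (Y⟦n⟧) - (a ≫ e.hom ≫ biprod.fst) ≫ s) (by
    change (𝟙 (Y⟦n⟧) - (a ≫ e.hom ≫ biprod.fst) ≫ s) ≫ a = 0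
    rw [Preadditive.sub_comp, Category.id_comp, Category.assoc, ← ha, sub_self])
  have hr₀ : r = 0 := hom_shiftsIn_eq_zero hP
    (fun i hi j hj => by simp only [Set.mem_singleton_iff] at hi hj; lia) hYn hX₀ r
  replace hr : 𝟙 (Y⟦n⟧) - (a ≫ e.hom ≫ biprod.fst) ≫ s = 0 := by
    rw [hr, hr₀]
    exact zero_comp
  have hfa : f ≫ a = 0 := comp_distTriang_mor_zero₁₂ _ hT
  calc f = f ≫ (a ≫ e.hom ≫ biprod.fst) ≫ s := by
        rw [← sub_eq_zero.1 hr, Category.comp_id]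
    _ = 0 := by rw [Category.assoc, reassoc_of% hfa, zero_comp]

omit hgen in
lemma addClosure_shiftsIn_univ_iff (X : D) : addClosure (shiftsIn P Set.univ) X ↔
    addClosure (⨆ n : ℤ, P.map (shiftFunctor D n)) X := by
  have : shiftsIn P Set.univ = ⨆ n : ℤ, P.map (shiftFunctor D n) := by
    ext X
    rw [prop_iSup_map_shift_iff]
    simp [shiftsIn]
  rw [this]

/-- A subcategory which generates `D` and has no negative morphisms is the heart of a hereditary
t-structure, whose aisle is generated by its nonnegative shifts. -/
lemma isHeartOfHereditaryTStructure_of_isGeneratingWithoutNegativeHom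
    [HasFiniteBiproducts P.FullSubcategory] (h : IsGeneratingWithoutNegativeHom P) :
    IsHeartOfHereditaryTStructure P := by
  have hgen (X : D) : addClosure (shiftsIn P Set.univ) X :=
    (addClosure_shiftsIn_univ_iff X).2 (h.1 X)
  refine ⟨generatedTStructure h.2 hgen, ⟨generatedTStructure_bounded h.2 hgen, ?_⟩,
    generatedTStructure_heart h.2 hgen⟩
  intro X Y hX hY n hn f
  rw [generatedTStructure_heart] at hX hY
  obtain ⟨X', hX', ⟨e⟩⟩ := hX
  obtain ⟨Y', hY', ⟨e'⟩⟩ := hY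
  rw [← cancel_epi e.inv, ← cancel_mono (e'.hom⟦n⟧'),
    hom_eq_zero_of_two_le h.2 hgen hX' hY' n hn ((e.inv ≫ f) ≫ e'.hom⟦n⟧')]
  simp

/-- The heart of a hereditary t-structure generates `D` and has no negative morphisms. -/
lemma isGeneratingWithoutNegativeHom_of_isHeartOfHereditaryTStructure
    (h : IsHeartOfHereditaryTStructure P) : IsGeneratingWithoutNegativeHom P := by
  obtain ⟨t, ht, hP⟩ := h
  constructor
  · intro X
    refine addClosure_mono ?_ (addClosure_of_bounded t ht.hom_eq_zero X (ht.bounded X))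
    intro Z hZ
    rw [prop_iSup_map_shift_iff] at hZ ⊢
    obtain ⟨n, Y, hY, ⟨e⟩⟩ := hZ
    rw [hP] at hY
    obtain ⟨Y', hY', ⟨e'⟩⟩ := hY
    exact ⟨n, Y', hY', ⟨(shiftFunctor D n).mapIso e'.symm ≪≫ e⟩⟩
  · intro X Y hX hY m hm f
    have hX' : t.heart X := by
      rw [hP]
      exact P.le_isoClosure _ hX
    have hY' : t.heart Y := by
      rw [hP]
      exact P.le_isoClosure _ hY
    have := ((t.mem_heart_iff _).1 hX').1
    have := ((t.mem_heart_iff _).1 hY').2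
    have := t.isGE_shift Y 0 m (-m) (by lia)
    exact t.zero f 0 (-m) (by lia)

end TStructure

/-! ### Vanishing of morphisms in the derived category -/

section DerivedCategory

universe w

variable {A : Type u} [Category.{v} A] [Abelian A] [HasDerivedCategory.{w} A]

lemma essImage_singleFunctor :
    (DerivedCategory.singleFunctor A 0).essImage =
      (DerivedCategory.TStructure.t (C := A)).heart := by
  ext Z
  rw [TStructure.mem_heart_iff]
  constructor
  · rintro ⟨X, ⟨e⟩⟩
    exact ⟨TStructure.isLE_of_iso _ e 0, TStructure.isGE_of_iso _ e 0⟩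
  · rintro ⟨_, _⟩
    obtain ⟨X, ⟨e⟩⟩ := DerivedCategory.exists_iso_singleFunctor_obj_of_isGE_of_isLE Z 0
    exact ⟨X, ⟨e.symm⟩⟩

lemma isHeartEmbedding_singleFunctor :
    IsHeartEmbedding (DerivedCategory.singleFunctor A 0) :=
  isHeartEmbedding_of_essImage_eq_heart _ essImage_singleFunctor

lemma hom_singleFunctor_eq_zero_of_isHereditaryAbelian (hA : IsHereditaryAbelian A)
    ⦃X Y : A⦄ ⦃n : ℤ⦄ (f : (DerivedCategory.singleFunctor A 0).obj X ⟶
      ((DerivedCategory.singleFunctor A 0).obj Y)⟦n⟧) (hn : 2 ≤ n) : f = 0 := by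
  let _ : HasExt.{max u v} A := HasExt.standard A
  obtain ⟨k, rfl⟩ := Int.eq_ofNat_of_zero_le (show 0 ≤ n by lia)
  have := hA X Y k (by lia)
  exact (Abelian.Ext.homEquiv (X := X) (Y := Y) (n := k)).symm.injective (Subsingleton.elim _ _)

lemma isHereditaryAbelian_of_hom_singleFunctor_eq_zero
    (h : ∀ (n : ℕ) (X Y : A) (f : (DerivedCategory.singleFunctor A 0).obj X ⟶
      ((DerivedCategory.singleFunctor A 0).obj Y)⟦(n + 2 : ℤ)⟧), f = 0) :
    IsHereditaryAbelian A := by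
  let _ : HasExt.{max u v} A := HasExt.standard A
  intro X Y n hn
  obtain ⟨k, rfl⟩ := Nat.exists_eq_add_of_le' hn
  have : Subsingleton (ShiftedHom ((DerivedCategory.singleFunctor A 0).obj X)
      ((DerivedCategory.singleFunctor A 0).obj Y) ((k + 2 : ℕ) : ℤ)) :=
    ⟨fun f g => (h k X Y f).trans (h k X Y g).symm⟩
  exact (Abelian.Ext.homEquiv (X := X) (Y := Y) (n := k + 2)).injective.subsingleton

omit [HasDerivedCategory.{w} A] in
/-- The subcomplex `K⁰`, placed in degree `0`, of a cochain complex `K` in degrees `≤ 0` detects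
whether a morphism from `K` to a stalk complex vanishes. -/
lemma exists_single_map_eq_comp {K : CochainComplex A ℤ} [K.IsStrictlyLE 0] {X : A}
    (π : K ⟶ (HomologicalComplex.single A (ComplexShape.up ℤ) 0).obj X) :
    ∃ (σ : (HomologicalComplex.single A (ComplexShape.up ℤ) 0).obj (K.X 0) ⟶ K)
      (p : K.X 0 ⟶ X), (HomologicalComplex.single A (ComplexShape.up ℤ) 0).map p = σ ≫ π ∧
      ∀ ⦃Z : A⦄ (c : X ⟶ Z), p ≫ c = 0 →
        π ≫ (HomologicalComplex.single A (ComplexShape.up ℤ) 0).map c = 0 := by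
  let σ : (HomologicalComplex.single A (ComplexShape.up ℤ) 0).obj (K.X 0) ⟶ K :=
    HomologicalComplex.mkHomFromSingle (𝟙 _) (by
      rintro _ rfl
      exact (K.isZero_of_isStrictlyLE 0 (0 + 1) (by simp)).eq_of_tgt _ _)
  have hσ : Epi (σ.f 0) := by
    rw [HomologicalComplex.mkHomFromSingle_f, Category.comp_id]
    infer_instance
  obtain ⟨p, hp⟩ := (HomologicalComplex.single A (ComplexShape.up ℤ) 0).map_surjective (σ ≫ π)
  refine ⟨σ, p, hp, fun Z c hc => ?_⟩
  apply HomologicalComplex.to_single_hom_ext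
  rw [← cancel_epi (σ.f 0), ← HomologicalComplex.comp_f, ← Category.assoc, ← hp,
    ← Functor.map_comp, hc, Functor.map_zero]
  simp

/-- Morphisms of positive degree are effaceable. A morphism from the stalk complex of `X` to an
object `W` in negative degrees is represented by a quasi-isomorphism `K ⟶ X` and a morphism
`K ⟶ L` where `K` is concentrated in degrees `≤ 0`, and it vanishes on the subcomplex of `K` which
is `K⁰` placed in degree `0`, where `K⁰ ⟶ X` is an epimorphism. -/
lemma exists_epi_comp_eq_zero {X : A} {W : DerivedCategory A} {n : ℤ} (hn : n < 0)
    (hW : W.IsLE n) (φ : (DerivedCategory.singleFunctor A 0).obj X ⟶ W) :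
    ∃ (X' : A) (p : X' ⟶ X), Epi p ∧ (DerivedCategory.singleFunctor A 0).map p ≫ φ = 0 := by
  obtain ⟨L, e, _⟩ := hW
  let φ' : DerivedCategory.Q.obj ((HomologicalComplex.single A (ComplexShape.up ℤ) 0).obj X) ⟶
    DerivedCategory.Q.obj L := φ ≫ e.hom
  obtain ⟨K, _, π, hπ, g, hg⟩ := DerivedCategory.right_fac_of_isStrictlyLE φ' 0
  obtain ⟨σ, p, hp, hc⟩ := exists_single_map_eq_comp π
  refine ⟨K.X 0, p, (Preadditive.epi_iff_cancel_zero p).2 fun Z c h => ?_, ?_⟩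
  · apply (DerivedCategory.singleFunctor A 0).map_injective
    have h' : DerivedCategory.Q.map ((HomologicalComplex.single A (ComplexShape.up ℤ) 0).map c) =
        0 := by
      rw [← cancel_epi (DerivedCategory.Q.map π), ← DerivedCategory.Q.map_comp, hc c h,
        Functor.map_zero, comp_zero]
    rw [Functor.map_zero]
    exact h'
  · have h₁ : σ ≫ g = 0 := by
      apply HomologicalComplex.from_single_hom_ext
      exact (L.isZero_of_isStrictlyLE n 0 hn).eq_of_tgt _ _
    have h₂ : DerivedCategory.Q.map
        ((HomologicalComplex.single A (ComplexShape.up ℤ) 0).map p) ≫ φ' = 0 := by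
      rw [hp, hg, DerivedCategory.Q.map_comp, Category.assoc, IsIso.hom_inv_id_assoc,
        ← DerivedCategory.Q.map_comp, h₁, Functor.map_zero]
    rw [← cancel_mono e.hom, Category.assoc, zero_comp]
    exact h₂

namespace IsHeartEmbedding

variable {D : Type*} [Category* D] [Preadditive D] [HasZeroObject D] [HasShift D ℤ]
  [∀ n : ℤ, (shiftFunctor D n).Additive] [Pretriangulated D]
  {ι' : A ⥤ D} [ι'.Full] [ι'.Faithful] [ι'.Additive] (hι' : IsHeartEmbedding ι')

omit [HasDerivedCategory.{w} A] in
include hι' in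
/-- The composition of two morphisms of degree `1` vanishes for every embedding `ι` of `A` as a
heart, as soon as there are no nonzero morphisms of degree `2` for one embedding `ι'`: the latter
means that the first extension lifts along the epimorphism of the second one, and this lifting can
be transported. -/
lemma comp_shift_eq_zero (h₂ : ∀ (X Y : A) (f : ι'.obj X ⟶ (ι'.obj Y)⟦(2 : ℤ)⟧), f = 0)
    {C : Type*} [Category* C] [Preadditive C] [HasZeroObject C] [HasShift C ℤ]
    [∀ n : ℤ, (shiftFunctor C n).Additive] [Pretriangulated C]
    {ι : A ⥤ C} [ι.Full] [ι.Faithful] [ι.Additive] (hι : IsHeartEmbedding ι)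
    {X Y Z : A} (δ : ι.obj X ⟶ (ι.obj Y)⟦(1 : ℤ)⟧) (γ : ι.obj Y ⟶ (ι.obj Z)⟦(1 : ℤ)⟧) :
    δ ≫ γ⟦(1 : ℤ)⟧' = 0 := by
  obtain ⟨E, i, q, hT⟩ := hι.exists_triangle_of_hom γ
  obtain ⟨w, hS⟩ := hι.exists_shortExact hT
  obtain ⟨γ', hT'⟩ := hι'.exists_triangle_of_shortExact _ hS
  change ι'.obj Y ⟶ (ι'.obj Z)⟦(1 : ℤ)⟧ at γ'
  have h₀ : mapExtension hι hι' δ ≫ γ'⟦(1 : ℤ)⟧' = 0 := by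
    rw [← cancel_mono ((shiftFunctorAdd' D (1 : ℤ) 1 2 (by lia)).inv.app (ι'.obj Z)), zero_comp]
    exact h₂ _ _ _
  obtain ⟨ε', hε'⟩ : ∃ ε' : ι'.obj X ⟶ (ι'.obj E)⟦(1 : ℤ)⟧,
      mapExtension hι hι' δ = ε' ≫ (ι'.map q)⟦(1 : ℤ)⟧' := by
    obtain ⟨ε, hε⟩ := Triangle.coyoneda_exact₁ _
      (rot_of_distTriang _ (rot_of_distTriang _ hT')) (mapExtension hι hι' δ) h₀
    change ι'.obj X ⟶ (ι'.obj E)⟦(1 : ℤ)⟧ at ε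
    change _ = ε ≫ (-(ι'.map q)⟦(1 : ℤ)⟧') at hε
    exact ⟨-ε, by rw [hε, Preadditive.comp_neg, Preadditive.neg_comp]⟩
  have hδ : δ = mapExtension hι' hι ε' ≫ (ι.map q)⟦(1 : ℤ)⟧' := by
    rw [← mapExtension_comp_map, ← hε', mapExtension_mapExtension]
  have hq : ι.map q ≫ γ = 0 := comp_distTriang_mor_zero₂₃ _ hT
  rw [hδ, Category.assoc, ← Functor.map_comp, hq, Functor.map_zero, comp_zero]

end IsHeartEmbedding

/-- By effaceability, a morphism of positive degree `m` in the derived category is the composition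
of the connecting morphism of a short exact sequence and of a morphism of degree `m - 1`. -/
lemma exists_eq_comp_shift {X Y : A} {k m : ℤ} (hkm : k + 1 = m) (hk : 0 ≤ k)
    (f : (DerivedCategory.singleFunctor A 0).obj X ⟶
      ((DerivedCategory.singleFunctor A 0).obj Y)⟦m⟧) :
    ∃ (K : A) (δ : (DerivedCategory.singleFunctor A 0).obj X ⟶
        ((DerivedCategory.singleFunctor A 0).obj K)⟦(1 : ℤ)⟧)
      (g : (DerivedCategory.singleFunctor A 0).obj K ⟶
        ((DerivedCategory.singleFunctor A 0).obj Y)⟦k⟧),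
      f = δ ≫ g⟦(1 : ℤ)⟧' ≫ (shiftFunctorAdd' (DerivedCategory A) k 1 m hkm).inv.app _ := by
  have hW : (((DerivedCategory.singleFunctor A 0).obj Y)⟦m⟧).IsLE (-m) :=
    DerivedCategory.TStructure.t.isLE_shift ((DerivedCategory.singleFunctor A 0).obj Y) 0 m (-m)
      (by lia)
  obtain ⟨X', p, _, hp⟩ := exists_epi_comp_eq_zero (by lia) hW f
  have hS : (ShortComplex.mk (kernel.ι p) p (kernel.condition p)).ShortExact :=
    { exact := ShortComplex.exact_of_f_is_kernel _ (kernelIsKernel p) }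
  obtain ⟨δ, hT⟩ := isHeartEmbedding_singleFunctor.exists_triangle_of_shortExact _ hS
  change _ ⟶ ((DerivedCategory.singleFunctor A 0).obj (kernel p))⟦(1 : ℤ)⟧ at δ
  obtain ⟨g, rfl⟩ := Triangle.yoneda_exact₃ _ hT f hp
  refine ⟨kernel p, δ, (shiftedHomUpEquiv _ _ k 1 m hkm).symm g, ?_⟩
  exact congr_arg (δ ≫ ·) ((shiftedHomUpEquiv _ _ k 1 m hkm).apply_symm_apply g).symm

/-- If morphisms of degree `2` vanish for one embedding of `A` as a heart, then all morphisms of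
degree `≥ 2` vanish in the derived category: those of degree `2` are compositions of two
morphisms of degree `1`, and those of higher degrees factor through lower degrees. -/
lemma hom_singleFunctor_eq_zero {D : Type*} [Category* D] [Preadditive D] [HasZeroObject D]
    [HasShift D ℤ] [∀ n : ℤ, (shiftFunctor D n).Additive] [Pretriangulated D]
    {ι' : A ⥤ D} [ι'.Full] [ι'.Faithful] [ι'.Additive] (hι' : IsHeartEmbedding ι')
    (h₂ : ∀ (X Y : A) (f : ι'.obj X ⟶ (ι'.obj Y)⟦(2 : ℤ)⟧), f = 0) (n : ℕ) :
    ∀ (X Y : A) (f : (DerivedCategory.singleFunctor A 0).obj X ⟶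
      ((DerivedCategory.singleFunctor A 0).obj Y)⟦(n + 2 : ℤ)⟧), f = 0 := by
  induction n with
  | zero =>
    intro X Y f
    obtain ⟨K, δ, g, rfl⟩ := exists_eq_comp_shift (k := 1) (by simp) (by simp) f
    rw [← Category.assoc, hι'.comp_shift_eq_zero h₂ isHeartEmbedding_singleFunctor δ g, zero_comp]
  | succ n hn =>
    intro X Y f
    obtain ⟨K, δ, g, rfl⟩ := exists_eq_comp_shift (k := n + 2) (by push_cast; ring) (by lia) f
    rw [hn _ _ g, Functor.map_zero, zero_comp, comp_zero]

end DerivedCategory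

/-! ### The equivalence with the bounded derived category -/

section Existence

variable {A : Type*} [Category* A]
  {C : Type u} [Category.{v} C] [Preadditive C] [HasZeroObject C] [HasShift C ℤ]
  [∀ n : ℤ, (shiftFunctor C n).Additive] [Pretriangulated C]
  {D : Type*} [Category* D] [Preadditive D] [HasZeroObject D] [HasShift D ℤ]
  [∀ n : ℤ, (shiftFunctor D n).Additive] [Pretriangulated D]

/-- An object which is built from shifts of objects of `A` can be matched with an object of `D`.
The property `Q` serves to keep track of where the latter can be found. -/
lemma exists_matching (ι : A ⥤ C) (ι' : A ⥤ D) (P : ObjectProperty C)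
    (hP : ∀ X, P X → ∃ a, Nonempty (ι.obj a ≅ X)) (Q : ObjectProperty D)
    (hQ₀ : ∀ X, IsZero X → Q X) (hQ₁ : ∀ (a : A) (n : ℤ), Q ((ι'.obj a)⟦n⟧))
    (hQ₂ : ∀ X Y, Q X → Q Y → Q (X ⊞ Y)) {Z : C}
    (hZ : addClosure (⨆ n : ℤ, P.map (shiftFunctor C n)) Z) :
    ∃ W, Q W ∧ Nonempty (Matching ι ι' Z W) := by
  induction hZ with
  | of_mem X hX =>
    obtain ⟨n, Y, hY, ⟨e⟩⟩ := (prop_iSup_map_shift_iff _ _).1 hX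
    obtain ⟨a, ⟨e'⟩⟩ := hP Y hY
    exact ⟨_, hQ₁ a n, ⟨((Matching.single ι ι' a).shift n).ofIso
      ((shiftFunctor C n).mapIso e' ≪≫ e) (Iso.refl _)⟩⟩
  | of_isZero X hX =>
    exact ⟨_, hQ₀ _ (isZero_zero D), ⟨.zero hX (isZero_zero D)⟩⟩
  | biprod X Y _ _ hX hY =>
    obtain ⟨W, hW, ⟨z⟩⟩ := hX
    obtain ⟨W', hW', ⟨z'⟩⟩ := hY
    exact ⟨W ⊞ W', hQ₂ _ _ hW hW', ⟨z.biprod z'⟩⟩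
  | of_iso X Y e _ hX =>
    obtain ⟨W, hW, ⟨z⟩⟩ := hX
    exact ⟨W, hW, ⟨z.ofIso e (Iso.refl _)⟩⟩

lemma bounded_biprod (t : TStructure D) {X Y : D} (hX : t.bounded X) (hY : t.bounded Y) :
    t.bounded (X ⊞ Y) :=
  t.bounded.ext_of_isTriangulatedClosed₂ _ (binaryBiproductTriangle_distinguished X Y) hX hY

end Existence

section Equivalence

variable {A : Type u} [Category.{v} A] [Abelian A] [HasDerivedCategory.{max u v} A]

/-- The bounded objects of the derived category of a hereditary abelian category are direct sums
of shifts of stalk complexes. -/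
lemma addClosure_derivedCategory
    (hA : ∀ ⦃X Y : A⦄ ⦃n : ℤ⦄ (f : (DerivedCategory.singleFunctor A 0).obj X ⟶
      ((DerivedCategory.singleFunctor A 0).obj Y)⟦n⟧), 2 ≤ n → f = 0)
    (b : DerivedCategory.Bounded A) :
    addClosure (⨆ n : ℤ, (DerivedCategory.TStructure.t (C := A)).heart.map
      (shiftFunctor (DerivedCategory A) n)) b.obj := by
  refine addClosure_of_bounded _ (fun X Y hX hY n hn f => ?_) _ b.property
  rw [← essImage_singleFunctor] at hX hY
  obtain ⟨X', ⟨e⟩⟩ := hX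
  obtain ⟨Y', ⟨e'⟩⟩ := hY
  rw [← cancel_epi e.hom, ← cancel_mono (e'.inv⟦n⟧'), comp_zero, zero_comp]
  exact hA _ hn

variable {D : Type u} [Category.{v} D] [Preadditive D] [HasZeroObject D] [HasShift D ℤ]
  [∀ n : ℤ, (shiftFunctor D n).Additive] [Pretriangulated D]

/-- An abelian category `A` embedded as the heart of a hereditary t-structure is hereditary, and the
functor attached to a choice of matchings of bounded complexes with objects of `D` is an
equivalence. -/
lemma exists_equivalence_of_essImage_eq_heart (t : TStructure D) (ht : IsHereditaryTStructure t)
    (ι' : A ⥤ D) [ι'.Full] [ι'.Faithful] [ι'.Additive] (hι' : ι'.essImage = t.heart) :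
    IsHereditaryAbelian A ∧ ∃ F : DerivedCategory.Bounded A ⥤ D, F.IsEquivalence ∧
      Nonempty (shiftFunctor (DerivedCategory.Bounded A) (1 : ℤ) ⋙ F ≅
        F ⋙ shiftFunctor D (1 : ℤ)) ∧
      Nonempty (canonicalEmbedding A ⋙ F ≅ ι') := by
  have hD : ∀ ⦃X Y : A⦄ ⦃n : ℤ⦄ (f : ι'.obj X ⟶ (ι'.obj Y)⟦n⟧), 2 ≤ n → f = 0 := by
    intro X Y n f hn
    refine ht.hom_eq_zero _ _ ?_ ?_ n hn f <;> rw [← hι'] <;> exact ι'.obj_mem_essImage _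
  have hE : IsHeartEmbedding ι' := isHeartEmbedding_of_essImage_eq_heart t hι'
  have hC' := hom_singleFunctor_eq_zero hE (fun X Y f => hD f le_rfl)
  have hC : ∀ ⦃X Y : A⦄ ⦃n : ℤ⦄ (f : (DerivedCategory.singleFunctor A 0).obj X ⟶
      ((DerivedCategory.singleFunctor A 0).obj Y)⟦n⟧), 2 ≤ n → f = 0 := by
    intro X Y n f hn
    obtain ⟨k, rfl⟩ : ∃ k : ℕ, n = k + 2 := ⟨(n - 2).toNat, by lia⟩
    exact hC' k X Y f
  refine ⟨isHereditaryAbelian_of_hom_singleFunctor_eq_zero hC', ?_⟩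
  let ψ : GradedIso (DerivedCategory.singleFunctor A 0) ι' :=
    isHeartEmbedding_singleFunctor.gradedIso hE hC hD
  choose W _ m using fun b : DerivedCategory.Bounded A => exists_matching
    (DerivedCategory.singleFunctor A 0) ι' _
    (fun X hX => by rwa [← essImage_singleFunctor] at hX) ⊤ (by simp) (by simp) (by simp)
    (addClosure_derivedCategory hC b)
  let m' : ∀ b : DerivedCategory.Bounded A, Matching (DerivedCategory.singleFunctor A 0) ι'
    ((DerivedCategory.Bounded.ι (C := A)).obj b) (W b) := fun b => (m b).some
  refine ⟨matchingFunctor ψ (DerivedCategory.Bounded.ι (C := A)) W m',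
    isEquivalence_matchingFunctor _ _ _ _ (fun V => ?_),
    ⟨matchingFunctorCommShift _ _ _ _ 1⟩,
    ⟨matchingFunctorCompIso _ _ _ _ _ (ObjectProperty.liftCompιIso _ _ _)⟩⟩
  obtain ⟨Z, hZ, ⟨z⟩⟩ := exists_matching ι' (DerivedCategory.singleFunctor A 0) _
    (fun X hX => by rwa [← hι'] at hX) (DerivedCategory.TStructure.t (C := A)).bounded
    (fun X hX => ObjectProperty.prop_of_isZero _ hX)
    (fun a n => (DerivedCategory.TStructure.t (C := A)).bounded.le_shift n _
      ⟨⟨0, inferInstance⟩, ⟨0, inferInstance⟩⟩)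
    (fun X Y hX hY => bounded_biprod _ hX hY)
    (addClosure_of_bounded t ht.hom_eq_zero V (ht.bounded V))
  exact ⟨⟨Z, hZ⟩, ⟨z.symm⟩⟩

/-- If `P` is the heart of a hereditary t-structure, then it is a hereditary abelian category and
its bounded derived category is equivalent to `D`. -/
lemma isHereditaryAbelianWithDerivedEquivalence_of_isHeartOfHereditaryTStructure
    [IsTriangulated D] (P : ObjectProperty D) [HasFiniteBiproducts P.FullSubcategory]
    (h : IsHeartOfHereditaryTStructure P) : IsHereditaryAbelianWithDerivedEquivalence P := by
  obtain ⟨t, ht, hP⟩ := h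
  have hess : P.ι.essImage = t.heart := by
    rw [hP]
    ext X
    constructor
    · rintro ⟨Y, ⟨e⟩⟩
      exact ⟨Y.obj, Y.property, ⟨e.symm⟩⟩
    · rintro ⟨Y, hY, ⟨e⟩⟩
      exact ⟨⟨Y, hY⟩, ⟨e.symm⟩⟩
  let _ : Abelian P.FullSubcategory := AbelianSubcategory.abelian P.ι
    (hom_eq_zero_of_neg t hess) (admissibleMorphism_eq_top t hess)
  let _ : HasDerivedCategory.{max u v} P.FullSubcategory :=
    HasDerivedCategory.standard P.FullSubcategory
  exact ⟨inferInstance, exists_equivalence_of_essImage_eq_heart t ht P.ι hess⟩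

end Equivalence

/-! ### Generation by the image of the stalk complexes -/

section Generation

variable {D : Type u} [Category.{v} D] [Preadditive D] [HasZeroObject D] [HasShift D ℤ]
  [∀ n : ℤ, (shiftFunctor D n).Additive] [Pretriangulated D]

omit [Preadditive D] [HasZeroObject D] [∀ n : ℤ, (shiftFunctor D n).Additive]
  [Pretriangulated D] in
/-- A functor commuting with the translation functors commutes with all their powers. -/
lemma nonempty_map_shift_iso {B : Type*} [Category* B] [HasShift B ℤ] {F : B ⥤ D}
    (e : shiftFunctor B (1 : ℤ) ⋙ F ≅ F ⋙ shiftFunctor D (1 : ℤ)) (n : ℤ) (Z : B) :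
    Nonempty (F.obj (Z⟦n⟧) ≅ (F.obj Z)⟦n⟧) := by
  have key (k : ℕ) (Z : B) : Nonempty (F.obj (Z⟦(k : ℤ)⟧) ≅ (F.obj Z)⟦(k : ℤ)⟧) := by
    induction k with
    | zero =>
      exact ⟨F.mapIso ((shiftFunctorZero' B _ (by simp)).app Z) ≪≫
        ((shiftFunctorZero' D _ (by simp)).app (F.obj Z)).symm⟩
    | succ k hk =>
      obtain ⟨e'⟩ := hk
      exact ⟨F.mapIso ((shiftFunctorAdd' B (k : ℤ) 1 _ (by simp)).app Z) ≪≫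
        e.app _ ≪≫ (shiftFunctor D (1 : ℤ)).mapIso e' ≪≫
        ((shiftFunctorAdd' D (k : ℤ) 1 _ (by simp)).app (F.obj Z)).symm⟩
  obtain ⟨k, rfl | rfl⟩ := Int.eq_nat_or_neg n
  · exact key k Z
  · obtain ⟨e'⟩ := key k (Z⟦(-k : ℤ)⟧)
    exact ⟨((shiftEquiv D (k : ℤ)).unitIso.app _) ≪≫
      (shiftFunctor D (-k : ℤ)).mapIso (e'.symm ≪≫
        F.mapIso ((shiftEquiv B (k : ℤ)).counitIso.app Z))⟩

variable {A : Type u} [Category.{v} A] [Abelian A] [HasDerivedCategory.{max u v} A]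
  {F : DerivedCategory.Bounded A ⥤ D} [F.IsEquivalence]
  (e : shiftFunctor (DerivedCategory.Bounded A) (1 : ℤ) ⋙ F ≅ F ⋙ shiftFunctor D (1 : ℤ))
  {ι' : A ⥤ D} (i : canonicalEmbedding A ⋙ F ≅ ι')

include e i

lemma hom_eq_zero_of_equivalence {X Y : A} {m : ℤ} (hm : m < 0)
    (f : ι'.obj X ⟶ (ι'.obj Y)⟦m⟧) : f = 0 := by
  obtain ⟨e'⟩ := nonempty_map_shift_iso e m ((canonicalEmbedding A).obj Y)
  obtain ⟨g, hg⟩ := F.map_surjective (i.hom.app X ≫ f ≫ (i.inv.app Y)⟦m⟧' ≫ e'.inv)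
  have hg₀ : g = 0 := (DerivedCategory.Bounded.ι (C := A)).map_injective (by
    rw [Functor.map_zero,
      ← cancel_mono (((DerivedCategory.Bounded.ι (C := A)).commShiftIso m).hom.app _), zero_comp]
    exact isHeartEmbedding_singleFunctor.hom_eq_zero _ hm)
  rw [hg₀, Functor.map_zero] at hg
  rw [← cancel_epi (i.hom.app X), ← cancel_mono ((i.inv.app Y)⟦m⟧' ≫ e'.inv), Category.assoc, ← hg,
    comp_zero, zero_comp]

/-- The image by `F` of a direct sum of shifts of stalk complexes is a direct sum of shifts of
objects of `A`. -/
lemma exists_addClosure_map {P : ObjectProperty D} (hP : ∀ X, P (ι'.obj X))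
    {Z : DerivedCategory A} (hZ : addClosure (⨆ n : ℤ,
      (DerivedCategory.TStructure.t (C := A)).heart.map (shiftFunctor (DerivedCategory A) n)) Z) :
    ∃ b : DerivedCategory.Bounded A, Nonempty (b.obj ≅ Z) ∧
      addClosure (⨆ n : ℤ, P.map (shiftFunctor D n)) (F.obj b) := by
  induction hZ with
  | of_mem X hX =>
    obtain ⟨n, Y, hY, ⟨α⟩⟩ := (prop_iSup_map_shift_iff _ _).1 hX
    rw [← essImage_singleFunctor] at hY
    obtain ⟨a, ⟨β⟩⟩ := hY
    obtain ⟨e'⟩ := nonempty_map_shift_iso e n ((canonicalEmbedding A).obj a)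
    refine ⟨((canonicalEmbedding A).obj a)⟦n⟧,
      ⟨((DerivedCategory.Bounded.ι (C := A)).commShiftIso n).app _ ≪≫
        (shiftFunctor _ n).mapIso β ≪≫ α⟩, .of_mem _ ?_⟩
    exact (prop_iSup_map_shift_iff _ _).2 ⟨n, _, hP a,
      ⟨(shiftFunctor D n).mapIso (i.symm.app a) ≪≫ e'.symm⟩⟩
  | of_isZero X hX =>
    exact ⟨0, ⟨((DerivedCategory.Bounded.ι (C := A)).map_isZero (isZero_zero _)).iso hX⟩,
      .of_isZero _ (F.map_isZero (isZero_zero _))⟩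
  | biprod X Y _ _ hX hY =>
    obtain ⟨b, ⟨α⟩, hb⟩ := hX
    obtain ⟨b', ⟨α'⟩, hb'⟩ := hY
    have := preservesBinaryBiproducts_of_preservesBinaryProducts F
    have := preservesBinaryBiproducts_of_preservesBiproducts (DerivedCategory.Bounded.ι (C := A))
    exact ⟨b ⊞ b', ⟨(DerivedCategory.Bounded.ι (C := A)).mapBiprod b b' ≪≫ biprod.mapIso α α'⟩,
      .of_iso _ _ (F.mapBiprod b b').symm (.biprod _ _ hb hb')⟩
  | of_iso X Y α _ hX =>
    obtain ⟨b, ⟨β⟩, hb⟩ := hX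
    exact ⟨b, ⟨β ≪≫ α⟩, hb⟩

omit e i

/-- If `P` is a hereditary abelian category whose bounded derived category is equivalent to `D`,
then the shifts of `P` generate `D` and there are no negative morphisms. -/
lemma isGeneratingWithoutNegativeHom_of_isHereditaryAbelianWithDerivedEquivalence
    (P : ObjectProperty D) (h : IsHereditaryAbelianWithDerivedEquivalence P) :
    IsGeneratingWithoutNegativeHom P := by
  obtain ⟨_, hA, F, _, ⟨e⟩, ⟨i⟩⟩ := h
  let _ : HasDerivedCategory.{max u v} P.FullSubcategory :=
    HasDerivedCategory.standard P.FullSubcategory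
  constructor
  · intro X
    obtain ⟨b, ⟨α⟩, hb⟩ := exists_addClosure_map e i (fun X => X.property)
      (addClosure_derivedCategory (hom_singleFunctor_eq_zero_of_isHereditaryAbelian hA)
        (F.objPreimage X))
    exact .of_iso _ _ (F.mapIso ((DerivedCategory.Bounded.ι
      (C := P.FullSubcategory)).preimageIso α) ≪≫ F.objObjPreimageIso X) hb
  · intro X Y hX hY m hm f
    exact hom_eq_zero_of_equivalence e i (X := ⟨X, hX⟩) (Y := ⟨Y, hY⟩) hm f

end Generation

end HereditaryTriangulated

theorem theorem2p2 {D : Type u} [Category.{v} D] [Preadditive D] [HasZeroObject D] [HasShift D ℤ]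
    [∀ n : ℤ, (shiftFunctor D n).Additive] [Pretriangulated D] [IsTriangulated D]
    (P : ObjectProperty D) [HasFiniteBiproducts P.FullSubcategory] :
    List.TFAE [
      HereditaryTriangulated.IsHeartOfHereditaryTStructure P,
      HereditaryTriangulated.IsGeneratingWithoutNegativeHom P,
      HereditaryTriangulated.IsHereditaryAbelianWithDerivedEquivalence P] := by
  tfae_have 1 → 2 :=
    HereditaryTriangulated.isGeneratingWithoutNegativeHom_of_isHeartOfHereditaryTStructure
  tfae_have 2 → 1 :=
    HereditaryTriangulated.isHeartOfHereditaryTStructure_of_isGeneratingWithoutNegativeHom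
  tfae_have 1 → 3 :=
    HereditaryTriangulated.isHereditaryAbelianWithDerivedEquivalence_of_isHeartOfHereditaryTStructure
      P
  tfae_have 3 → 2 :=
    HereditaryTriangulated.isGeneratingWithoutNegativeHom_of_isHereditaryAbelianWithDerivedEquivalence
      P
  tfae_finish
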